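/- Let $Q$ be a finite-dimensional smooth (Hausdorff, second countable) manifold and $\pi:Q\to\mathbb R$ a smooth, locally trivial fibre bundle whose typical fibre is a finite-dimensional smooth manifold, with bundle coordinates $(q^\lambda)=(q^0=t,q^i)$. Write $(t,q^i,\dot t,\dot q^i)$ for the induced coordinates on $TQ$, and identify the first order jet manifold $J^1Q$ of sections of $\pi$ with the submanifold $\{\dot t=1\}\subset TQ$ by the canonical imbedding $\lambda:(t,q^i,q^i_t)\mapsto(t,q^i,\dot t=1,\dot q^i=q^i_t)$; put $\partial_i^t=\partial/\partial q^i_t$. Likewise the second order jet manifold $J^2Q$ is identified with its image in $TTQ$ by $(t,q^i,q^i_t,q^i_{tt})\mapsto(\dot t=1,\ \dot q^i=q^i_t,\ \ddot t=0,\ \ddot q^i=q^i_{tt})$. Let $$\xi=\partial_t+q^i_t\partial_i+\xi^i(t,q^j,q^j_t)\,\partial_i^t$$ be a smooth holonomic connection on $J^1Q\to\mathbb R$. The associated dynamic equation $q^i_{tt}=\xi^i$ is the image $\xi(J^1Q)\subset J^2Q$; a motion of $\xi$ is a smooth section $c$ of $\pi$ over an open interval whose second order jet prolongation lies in this image. A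 dynamic connection is a smooth connection $\gamma=dq^\lambda\otimes(\partial_\lambda+\gamma^i_\lambda\partial_i^t)$ on $J^1Q\to Q$; it generates $\xi$ if $\xi^i=\gamma^i_0+q^j_t\gamma^i_j$. Then the following hold. 1. There is a dynamic connection $\gamma_\xi$ with components $\gamma^i_j=\tfrac12\partial_j^t\xi^i$ and $\gamma^i_0=\xi^i-\tfrac12 q^j_t\,\partial_j^t\xi^i$, and it generates $\xi$. 2. For every dynamic connection $\gamma$ generating $\xi$ (in particular for $\gamma_\xi$) there is a smooth, in general non-linear, connection $\widetilde K=dq^\lambda\otimes(\partial_\lambda+K^i_\lambda\,\partial/\partial\dot q^i)$ on $TQ\to Q$, i.e. one with $K^0_\mu=0$, such that $K^i_\mu\circ\lambda=\gamma^i_\mu$. 3. For every dynamic connection $\gamma$ generating $\xi$ and every connection $\widetilde K$ as in 2, the dynamic equation is equivalent to the geodesic equation $$\ddot t=0,\qquad \dot t=1,\qquad \ddot q^i=K^i_\lambda\dot q^\lambda$$ on $TQ$. That is, the two equations define the same subset of $TTQ$. Consequently a smooth section of $\pi$ over an open interval is a motion of $\xi$ if and only if it is a solution of the geodesic equation. A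 smooth curve $c$ in $Q$ defined on an open interval is a solution of the geodesic equation (i.e. its second tangent prolongation $\ddot c$ lies in it) if and only if, for some constant $a\in\mathbb R$, the shifted curve $s\mapsto c(s-a)$ is a motion of $\xi$. -/

import Mathlib

open Set Topology
open scoped Manifold ContDiff

noncomputable section

namespace TimeBundle

variable {E : Type*} [NormedAddCommGroup E] [NormedSpace ℝ E]
  {Q : Type*} [TopologicalSpace Q] [ChartedSpace E Q]

/-- `π : Q → ℝ` is a smooth (locally trivial) fibre bundle with typical fibre the manifold `M`:
around every instant there is a local trivialization over an open set of instants which is a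
diffeomorphism onto its image. -/
def IsSmoothBundle (F : Type*) [NormedAddCommGroup F] [NormedSpace ℝ F]
    (M : Type*) [TopologicalSpace M] [ChartedSpace F M] (π : Q → ℝ) : Prop :=
  ∀ t : ℝ, ∃ e : Bundle.Trivialization M π, t ∈ e.baseSet ∧
    ContMDiffOn 𝓘(ℝ, E) (𝓘(ℝ, ℝ).prod 𝓘(ℝ, F)) ∞ e e.source ∧
    ContMDiffOn (𝓘(ℝ, ℝ).prod 𝓘(ℝ, F)) 𝓘(ℝ, E) ∞ e.toOpenPartialHomeomorph.symm e.target

/-- The coordinate `ṫ` on `TQ`, i.e. the 1-form `dt` (pulled back to `Q` by `π`) seen as a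
function on the tangent bundle. -/
def tdot (π : Q → ℝ) (v : TangentBundle 𝓘(ℝ, E) Q) : ℝ :=
  (mfderiv 𝓘(ℝ, E) 𝓘(ℝ, ℝ) π v.proj v.2 : ℝ)

/-- The first order jet manifold `J¹Q` of sections of `π : Q → ℝ`, identified with its image
`ṫ = 1` under the canonical imbedding `λ : J¹Q → TQ`, which sends the 1-jet of a section to its
velocity. -/
def J1 (π : Q → ℝ) : Set (TangentBundle 𝓘(ℝ, E) Q) := {v | tdot π v = 1}

variable [IsManifold 𝓘(ℝ, E) ∞ Q]

/-- The linear function `ẗ` on the tangent space of `TQ` at `v`: the differential of `ṫ`. On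
`J¹Q` its kernel is the tangent space of `J¹Q`. -/
def tddot (π : Q → ℝ) (v : TangentBundle 𝓘(ℝ, E) Q)
    (ζ : TangentSpace (𝓘(ℝ, E).tangent) v) : ℝ :=
  (mfderiv 𝓘(ℝ, E).tangent 𝓘(ℝ, ℝ) (tdot π) v ζ : ℝ)

/-- The tangent map `TTQ → TQ` of the projection `TQ → Q`, at `v`. -/
def Tproj (v : TangentBundle 𝓘(ℝ, E) Q) (ζ : TangentSpace (𝓘(ℝ, E).tangent) v) :
    TangentSpace 𝓘(ℝ, E) v.proj :=
  mfderiv 𝓘(ℝ, E).tangent 𝓘(ℝ, E)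
    (Bundle.TotalSpace.proj : TangentBundle 𝓘(ℝ, E) Q → Q) v ζ

/-- The components `q̈^μ` of a tangent vector `ζ` of `TQ` at `v`, in the coordinates
`(q^μ, q̇^μ)` on `TQ` induced by the chart `φ = (q^μ)` of `Q`: the derivative along `ζ` of the
fibre coordinates `q̇^μ`. -/
def qddot (φ : OpenPartialHomeomorph Q E) (v : TangentBundle 𝓘(ℝ, E) Q)
    (ζ : TangentSpace (𝓘(ℝ, E).tangent) v) : E :=
  (mfderiv 𝓘(ℝ, E).tangent 𝓘(ℝ, E)
    (fun p : TangentBundle 𝓘(ℝ, E) Q => (mfderiv 𝓘(ℝ, E) 𝓘(ℝ, E) φ p.proj p.2 : E)) v ζ : E)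

/-- A holonomic connection `ξ = ∂_t + q^i_t ∂_i + ξ^i ∂_i^t` on `J¹Q → ℝ`: a smooth vector field
on `J¹Q` (a section of `TTQ` over `J¹Q`, tangent to `J¹Q`) whose value at `v` projects to `v`
itself. Values of `ξ` off `J¹Q` are irrelevant. -/
structure IsHolonomicConnection (π : Q → ℝ)
    (ξ : ∀ v : TangentBundle 𝓘(ℝ, E) Q, TangentSpace (𝓘(ℝ, E).tangent) v) : Prop where
  smooth : ContMDiffOn 𝓘(ℝ, E).tangent 𝓘(ℝ, E).tangent.tangent ∞
    (fun v => (⟨v, ξ v⟩ :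
      TangentBundle 𝓘(ℝ, E).tangent (TangentBundle 𝓘(ℝ, E) Q))) (J1 π)
  tangent : ∀ v ∈ J1 π, tddot π v (ξ v) = 0
  holonomic : ∀ v ∈ J1 π, Tproj v (ξ v) = v.2

/-- Smoothness on a set `S ⊆ TQ` of a family of linear maps `K v : T_{q} Q → T_v TQ`
(`v` over `q`), read in the tangent bundle charts. -/
def SmoothLiftOn
    (K : ∀ v : TangentBundle 𝓘(ℝ, E) Q,
      TangentSpace 𝓘(ℝ, E) v.proj →L[ℝ] TangentSpace (𝓘(ℝ, E).tangent) v)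
    (S : Set (TangentBundle 𝓘(ℝ, E) Q)) : Prop :=
  ∀ v ∈ S, ContMDiffWithinAt 𝓘(ℝ, E).tangent 𝓘(ℝ, E →L[ℝ] E × E) ∞
    (inTangentCoordinates 𝓘(ℝ, E) 𝓘(ℝ, E).tangent
      (Bundle.TotalSpace.proj : TangentBundle 𝓘(ℝ, E) Q → Q) id K v) S v

/-- A (non-linear) connection `K = dq^λ ⊗ (∂_λ + K^μ_λ ∂/∂q̇^μ)` on `TQ → Q`, given by its
horizontal lifts `w ↦ K v w`, `T_q Q → T_v TQ`. -/
structure IsConnection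
    (K : ∀ v : TangentBundle 𝓘(ℝ, E) Q,
      TangentSpace 𝓘(ℝ, E) v.proj →L[ℝ] TangentSpace (𝓘(ℝ, E).tangent) v) : Prop where
  smooth : SmoothLiftOn K univ
  lift : ∀ v w, Tproj v (K v w) = w

/-- A dynamic connection `γ = dq^λ ⊗ (∂_λ + γ^i_λ ∂_i^t)`, i.e. a connection on `J¹Q → Q`, given by
its horizontal lifts `T_q Q → T_v J¹Q ⊆ T_v TQ`, `v ∈ J¹Q`. Values of `γ` off `J¹Q` are
irrelevant. -/
structure IsDynamicConnection (π : Q → ℝ)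
    (γ : ∀ v : TangentBundle 𝓘(ℝ, E) Q,
      TangentSpace 𝓘(ℝ, E) v.proj →L[ℝ] TangentSpace (𝓘(ℝ, E).tangent) v) : Prop where
  smooth : SmoothLiftOn γ (J1 π)
  tangent : ∀ v ∈ J1 π, ∀ w, tddot π v (γ v w) = 0
  lift : ∀ v ∈ J1 π, ∀ w, Tproj v (γ v w) = w

/-- `γ` generates `ξ`: `ξ = ξ_γ`, the horizontal lift by `γ` of the total derivative
`d_t = ∂_t + q^i_t ∂_i`; in components `ξ^i = γ^i_0 + q^j_t γ^i_j`. -/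
def Generates (π : Q → ℝ)
    (γ : ∀ v : TangentBundle 𝓘(ℝ, E) Q,
      TangentSpace 𝓘(ℝ, E) v.proj →L[ℝ] TangentSpace (𝓘(ℝ, E).tangent) v)
    (ξ : ∀ v : TangentBundle 𝓘(ℝ, E) Q, TangentSpace (𝓘(ℝ, E).tangent) v) : Prop :=
  ∀ v ∈ J1 π, γ v v.2 = ξ v

/-- `γ` is the dynamic connection `γ_ξ` of `ξ`, with components
`γ^i_j = ½ ∂_j^t ξ^i` and `γ^i_0 = ξ^i - ½ q^j_t ∂_j^t ξ^i`. Contracted with a tangent vector `w`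
of `Q` this reads `γ^i_λ w^λ = dt(w) ξ^i + ½ u^j ∂_j^t ξ^i`, where `u = w - dt(w) v` is the vertical
part of `w`; note that `v + s u` stays in `J¹Q`. -/
def IsAssociatedConnection (π : Q → ℝ)
    (ξ : ∀ v : TangentBundle 𝓘(ℝ, E) Q, TangentSpace (𝓘(ℝ, E).tangent) v)
    (γ : ∀ v : TangentBundle 𝓘(ℝ, E) Q,
      TangentSpace 𝓘(ℝ, E) v.proj →L[ℝ] TangentSpace (𝓘(ℝ, E).tangent) v) : Prop :=
  ∀ φ ∈ IsManifold.maximalAtlas 𝓘(ℝ, E) ∞ Q,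
  ∀ (q : Q) (v w : TangentSpace 𝓘(ℝ, E) q), q ∈ φ.source →
    (⟨q, v⟩ : TangentBundle 𝓘(ℝ, E) Q) ∈ J1 π →
    qddot φ ⟨q, v⟩ (γ ⟨q, v⟩ w) =
      tdot π ⟨q, w⟩ • qddot φ ⟨q, v⟩ (ξ ⟨q, v⟩) +
      (1 / 2 : ℝ) • deriv (fun s : ℝ =>
        qddot φ ⟨q, v + s • (w - tdot π ⟨q, w⟩ • v)⟩
          (ξ ⟨q, v + s • (w - tdot π ⟨q, w⟩ • v)⟩)) 0

/-- The dynamic equation `q^i_tt = ξ^i`: the image of `ξ`, as a subset of `TTQ`. -/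
def dynamicEquation (π : Q → ℝ)
    (ξ : ∀ v : TangentBundle 𝓘(ℝ, E) Q, TangentSpace (𝓘(ℝ, E).tangent) v) :
    Set (TangentBundle 𝓘(ℝ, E).tangent (TangentBundle 𝓘(ℝ, E) Q)) :=
  (fun v => ⟨v, ξ v⟩) '' J1 π

/-- The system `ẗ = 0`, `ṫ = 1`, `q̈^μ = K^μ_λ q̇^λ`, as a subset of `TTQ`: the points with `ẗ = 0` and
`ṫ = 1` of the geodesic equation of `K`, which is the image of `v ↦ K v v`. -/
def geodesicEquation (π : Q → ℝ)
    (K : ∀ v : TangentBundle 𝓘(ℝ, E) Q,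
      TangentSpace 𝓘(ℝ, E) v.proj →L[ℝ] TangentSpace (𝓘(ℝ, E).tangent) v) :
    Set (TangentBundle 𝓘(ℝ, E).tangent (TangentBundle 𝓘(ℝ, E) Q)) :=
  {ζ | tddot π ζ.proj ζ.2 = 0 ∧ tdot π ζ.proj = 1 ∧ ζ ∈ range fun v =>
    (⟨v, K v v.2⟩ : TangentBundle 𝓘(ℝ, E).tangent (TangentBundle 𝓘(ℝ, E) Q))}

/-- The tangent prolongation `ċ` of a curve `c`. -/
def velocity (c : ℝ → Q) (s : ℝ) : TangentBundle 𝓘(ℝ, E) Q :=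
  ⟨c s, mfderiv 𝓘(ℝ, ℝ) 𝓘(ℝ, E) c s (1 : ℝ)⟩

/-- The second order tangent prolongation `c̈` of a curve `c`. -/
def acceleration (c : ℝ → Q) (s : ℝ) :
    TangentBundle 𝓘(ℝ, E).tangent (TangentBundle 𝓘(ℝ, E) Q) :=
  ⟨velocity c s, mfderiv 𝓘(ℝ, ℝ) 𝓘(ℝ, E).tangent (velocity (E := E) c) s (1 : ℝ)⟩

/-- The smooth curve `c : J → Q` is a solution of a second order equation `S ⊆ TTQ`. -/
def IsSolution (S : Set (TangentBundle 𝓘(ℝ, E).tangent (TangentBundle 𝓘(ℝ, E) Q)))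
    (J : Set ℝ) (c : ℝ → Q) : Prop :=
  ContMDiffOn 𝓘(ℝ, ℝ) 𝓘(ℝ, E) ∞ c J ∧ ∀ s ∈ J, acceleration c s ∈ S

/-- A motion of the dynamic equation `ξ` over `J`: a smooth section `c` of `π` over `J` whose second
order jet prolongation (in `J²Q ⊆ TTQ`) lies in the equation. -/
def IsMotion (π : Q → ℝ)
    (ξ : ∀ v : TangentBundle 𝓘(ℝ, E) Q, TangentSpace (𝓘(ℝ, E).tangent) v)
    (J : Set ℝ) (c : ℝ → Q) : Prop :=
  (∀ t ∈ J, π (c t) = t) ∧ IsSolution (dynamicEquation π ξ) J c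

end TimeBundle

end

noncomputable section

namespace TimeBundle

variable {E : Type*} [NormedAddCommGroup E] [NormedSpace ℝ E]
  {Q : Type*} [TopologicalSpace Q] [ChartedSpace E Q]
  {G : Type*} [NormedAddCommGroup G] [NormedSpace ℝ G]
  {F : Type*} [NormedAddCommGroup F] [NormedSpace ℝ F]
  {M : Type*} [TopologicalSpace M] [ChartedSpace F M]

/-! The bundle enters only through two facts: `π` is smooth, and every tangent space contains a
vector with `dt = 1`. A partition of unity then gives a global smooth field `X` with `dt(X) = 1`, a
reference frame, and `r(v) = v + (1 - ṫ) X` is a smooth retraction of `TQ` onto `J¹Q`.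

Both connections are defined point by point in the preferred chart at the base point, and everything
else follows from their behaviour under a change of coordinates. The second differential of a
function `g` at `v`, on a vector `ζ` over `w`, is `L ζ₂ + B(w, v)` with `B` symmetric
(`exists_tangentDeriv₂_eq`). A formula for lifts passes from the preferred chart to every smooth `g`
exactly when its `B`-terms add up to `B(w, v)`. Taking `g` to be a chart gives the coordinate
formulas and smoothness; taking `g = π` gives `ẗ = 0`.

For `γ_ξ`, write `w = a v + y` with `a = dt(w)`. The component of `ξ` contributes `B(v, v)`, whose
derivative along `y` is `2 B(y, v)`; the factor `1/2` leaves `a B(v, v) + B(y, v) = B(w, v)`.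

For the extension, `γ` is evaluated at `r(v)` and `(1 - ṫ) dX(w)` is subtracted, so that `B(w, r(v))
- (1 - ṫ) B(w, X) = B(w, v)`. In bundle coordinates with `X = ∂_t` the correction vanishes and `K`
is `γ` made independent of `ṫ`.

On `J¹Q` one has `K v v = γ v v = ξ v`, so the two equations are the same set. Along a solution `ṫ =
1`, hence `π ∘ c` is a translation, and shifting the parameter turns `c` into a section. -/

/-! ### Differentials and vectors with `dt = 1`. -/

/-- The differential of `g : Q → G`, as a function on the tangent bundle. -/
def tangentDeriv (g : Q → G) (p : TangentBundle 𝓘(ℝ, E) Q) : G :=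
  (mfderiv 𝓘(ℝ, E) 𝓘(ℝ, G) g p.proj p.2 : G)

theorem tangentDeriv_add (g : Q → G) {q : Q} (v w : TangentSpace 𝓘(ℝ, E) q) :
    tangentDeriv g (⟨q, v + w⟩ : TangentBundle 𝓘(ℝ, E) Q) =
      tangentDeriv g (⟨q, v⟩ : TangentBundle 𝓘(ℝ, E) Q) +
        tangentDeriv g (⟨q, w⟩ : TangentBundle 𝓘(ℝ, E) Q) :=
  map_add (mfderiv 𝓘(ℝ, E) 𝓘(ℝ, G) g q) v w

theorem tangentDeriv_smul (g : Q → G) {q : Q} (c : ℝ) (v : TangentSpace 𝓘(ℝ, E) q) :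
    tangentDeriv g (⟨q, c • v⟩ : TangentBundle 𝓘(ℝ, E) Q) =
      c • tangentDeriv g (⟨q, v⟩ : TangentBundle 𝓘(ℝ, E) Q) :=
  map_smul (mfderiv 𝓘(ℝ, E) 𝓘(ℝ, G) g q) c v

theorem IsSmoothBundle.contMDiff {π : Q → ℝ} (hπ : IsSmoothBundle (E := E) F M π) :
    ContMDiff 𝓘(ℝ, E) 𝓘(ℝ, ℝ) ∞ π := by
  intro q
  obtain ⟨e, he, hs, -⟩ := hπ (π q)
  have hq : q ∈ e.source := e.mem_source.2 he
  refine ((hs.contMDiffAt (e.open_source.mem_nhds hq)).fst).congr_of_eventuallyEq ?_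
  filter_upwards [e.open_source.mem_nhds hq] with y hy
  exact (e.coe_fst hy).symm

/-- Freezing the fibre component of `q` in a local trivialization gives a local section through `q`;
its velocity works, since `π ∘ σ = id` near `π q`. -/
theorem IsSmoothBundle.exists_tdot_eq_one {π : Q → ℝ} (hπ : IsSmoothBundle (E := E) F M π) (q : Q) :
    ∃ w : TangentSpace 𝓘(ℝ, E) q, tdot π ⟨q, w⟩ = 1 := by
  obtain ⟨e, he, hs, hs'⟩ := hπ (π q)
  have hq : q ∈ e.source := e.mem_source.2 he
  set σ : ℝ → Q := fun s => e.toOpenPartialHomeomorph.symm (s, (e q).2)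
  have hpt : (π q, (e q).2) = e q := Prod.ext (e.coe_fst hq).symm rfl
  have hσq : σ (π q) = q := by
    change e.toOpenPartialHomeomorph.symm (π q, (e q).2) = q
    rw [hpt]
    exact e.toOpenPartialHomeomorph.left_inv hq
  have htar : (π q, (e q).2) ∈ e.target := e.mem_target.2 he
  have hσ : MDifferentiableAt 𝓘(ℝ, ℝ) 𝓘(ℝ, E) σ (π q) := by
    have h1 : ContMDiffAt 𝓘(ℝ, ℝ) (𝓘(ℝ, ℝ).prod 𝓘(ℝ, F)) ∞
      (fun s : ℝ => (s, (e q).2)) (π q) := contMDiffAt_id.prodMk contMDiffAt_const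
    exact ((hs'.contMDiffAt (e.open_target.mem_nhds htar)).comp (π q) h1).mdifferentiableAt
      (by norm_num)
  have hπd : MDifferentiableAt 𝓘(ℝ, E) 𝓘(ℝ, ℝ) π (σ (π q)) :=
    hπ.contMDiff.contMDiffAt.mdifferentiableAt (by norm_num)
  have hc := mfderiv_comp (π q) hπd hσ
  have hid : π ∘ σ =ᶠ[𝓝 (π q)] id := by
    filter_upwards [e.open_baseSet.mem_nhds he] with s hs
    exact e.proj_symm_apply (e.mem_target.2 hs)
  rw [hid.mfderiv_eq, mfderiv_id] at hc
  have h1 := congrArg (fun L => (L (1 : ℝ) : ℝ)) hc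
  rw [← hσq]
  refine ⟨mfderiv 𝓘(ℝ, ℝ) 𝓘(ℝ, E) σ (π q) (1 : ℝ), ?_⟩
  rw [hσq] at *
  exact h1.symm

/-! ### The retraction of `TQ` onto `J¹Q`. -/

/-- The projection of `TQ` onto `J¹Q` along the reference frame `X`. -/
def jetProjection (π : Q → ℝ) (X : ∀ q : Q, TangentSpace 𝓘(ℝ, E) q)
    (v : TangentBundle 𝓘(ℝ, E) Q) : TangentBundle 𝓘(ℝ, E) Q :=
  ⟨v.proj, v.2 + (1 - tdot π v) • X v.proj⟩

theorem jetProjection_mem {π : Q → ℝ} {X : ∀ q : Q, TangentSpace 𝓘(ℝ, E) q}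
    (hX : ∀ q, tdot π ⟨q, X q⟩ = 1) (v : TangentBundle 𝓘(ℝ, E) Q) :
    jetProjection π X v ∈ J1 π := by
  change tangentDeriv π ⟨v.proj, _⟩ = 1
  rw [tangentDeriv_add, tangentDeriv_smul]
  change tdot π v + (1 - tdot π v) • tdot π ⟨_, X v.proj⟩ = 1
  simp [hX]

theorem jetProjection_of_mem {π : Q → ℝ} {X : ∀ q : Q, TangentSpace 𝓘(ℝ, E) q}
    {v : TangentBundle 𝓘(ℝ, E) Q} (hv : v ∈ J1 π) : jetProjection π X v = v := by
  have h : tdot π v = 1 := hv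
  simp [jetProjection, h]

theorem line_mem_J1 {π : Q → ℝ} {v : TangentBundle 𝓘(ℝ, E) Q} (hv : v ∈ J1 π)
    (w : TangentSpace 𝓘(ℝ, E) v.proj) (s : ℝ) :
    (⟨v.proj, v.2 + s • (w - tdot π ⟨v.proj, w⟩ • v.2)⟩ : TangentBundle 𝓘(ℝ, E) Q) ∈ J1 π := by
  have h : tdot π v = 1 := hv
  change tangentDeriv π ⟨v.proj, _⟩ = 1
  rw [tangentDeriv_add, tangentDeriv_smul, sub_eq_add_neg, tangentDeriv_add, ← neg_smul,
    tangentDeriv_smul]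
  change tdot π v + s • (tdot π _ + (-tdot π _) • tdot π v) = 1
  simp [h]

/-! ### Time translation of curves. -/

/-- No differentiability is assumed: shifting back shows that both sides are differentiable
together, and otherwise `mfderiv` is zero on both. Velocities of shifted curves therefore agree as
functions on all of `ℝ`, and can be differentiated again. -/
theorem mfderiv_comp_sub_const {E' : Type*} [NormedAddCommGroup E'] [NormedSpace ℝ E']
    {H : Type*} [TopologicalSpace H] {I : ModelWithCorners ℝ E' H}
    {N : Type*} [TopologicalSpace N] [ChartedSpace H N] (c : ℝ → N) (a s : ℝ) :
    mfderiv 𝓘(ℝ, ℝ) I (fun s => c (s - a)) s (1 : ℝ) =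
      mfderiv 𝓘(ℝ, ℝ) I c (s - a) (1 : ℝ) := by
  have hsub (b r : ℝ) : HasMFDerivAt 𝓘(ℝ, ℝ) 𝓘(ℝ, ℝ) (fun s : ℝ => s - b) r
      (ContinuousLinearMap.id ℝ ℝ) := ((hasFDerivAt_id r).sub_const b).hasMFDerivAt
  by_cases hc : MDifferentiableAt 𝓘(ℝ, ℝ) I c (s - a)
  · have h := (hc.hasMFDerivAt.comp s (hsub a s)).mfderiv
    exact congrArg (fun L => (L (1 : ℝ) : E')) h
  · have hc' : ¬ MDifferentiableAt 𝓘(ℝ, ℝ) I (fun s => c (s - a)) s := by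
      intro h
      refine hc ?_
      have h1 : MDifferentiableAt 𝓘(ℝ, ℝ) I (fun s => c (s - a)) ((fun r : ℝ => r - (-a)) (s - a)) := by
        simpa using h
      have h2 := h1.comp (s - a) (hsub (-a) (s - a)).mdifferentiableAt
      have h3 : (fun s => c (s - a)) ∘ (fun r : ℝ => r - (-a)) = c := by
        funext r
        simp
      rwa [h3] at h2
    rw [mfderiv_zero_of_not_mdifferentiableAt hc, mfderiv_zero_of_not_mdifferentiableAt hc']
    rfl

theorem velocity_comp_sub_const (c : ℝ → Q) (a s : ℝ) :
    velocity (E := E) (fun s => c (s - a)) s = velocity c (s - a) := by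
  unfold velocity
  rw [mfderiv_comp_sub_const (I := 𝓘(ℝ, E)) c a s]

/-- By the chain rule `π ∘ c - id` has zero derivative on the open connected set `J`. -/
theorem exists_forall_eq_add_of_tdot_eq_one {π : Q → ℝ} (hπ : ContMDiff 𝓘(ℝ, E) 𝓘(ℝ, ℝ) ∞ π)
    {J : Set ℝ} (hJ : IsOpen J) (hJc : J.OrdConnected) {c : ℝ → Q}
    (hc : ContMDiffOn 𝓘(ℝ, ℝ) 𝓘(ℝ, E) ∞ c J) (h : ∀ s ∈ J, tdot π (velocity (E := E) c s) = 1) :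
    ∃ a : ℝ, ∀ s ∈ J, π (c s) = s + a := by
  have hd : ∀ s ∈ J, HasDerivAt (fun s => π (c s) - s) 0 s := by
    intro s hs
    have h1 : MDifferentiableAt 𝓘(ℝ, ℝ) 𝓘(ℝ, E) c s :=
      (hc.contMDiffAt (hJ.mem_nhds hs)).mdifferentiableAt (by norm_num)
    set L : ℝ →L[ℝ] ℝ := (mfderiv 𝓘(ℝ, E) 𝓘(ℝ, ℝ) π (c s)).comp (mfderiv 𝓘(ℝ, ℝ) 𝓘(ℝ, E) c s)
    have h2 : HasFDerivAt (fun s => π (c s)) L s :=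
      (((hπ (c s)).mdifferentiableAt (by norm_num)).hasMFDerivAt.comp s
        h1.hasMFDerivAt).hasFDerivAt
    have h3 : L 1 = 1 := h s hs
    have h4 := h2.hasDerivAt.sub (hasDerivAt_id s)
    rwa [h3, sub_self] at h4
  obtain ⟨a, ha⟩ : ∃ a : ℝ, ∀ s ∈ J, π (c s) - s = a :=
    hJ.exists_is_const_of_deriv_eq_zero hJc.isPreconnected
      (fun s hs => (hd s hs).differentiableAt.differentiableWithinAt) (fun s hs => (hd s hs).deriv)
  exact ⟨a, fun s hs => by linarith [ha s hs]⟩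

/-! ### Second differentials and induced coordinates on `TQ` and `TTQ`. -/

variable [IsManifold 𝓘(ℝ, E) ∞ Q]

/-- The second differential of `g : Q → G`, as a function on the second tangent bundle. -/
def tangentDeriv₂ (g : Q → G) (v : TangentBundle 𝓘(ℝ, E) Q)
    (ζ : TangentSpace (𝓘(ℝ, E).tangent) v) : G :=
  (mfderiv 𝓘(ℝ, E).tangent 𝓘(ℝ, G) (tangentDeriv g) v ζ : G)

theorem tddot_eq (π : Q → ℝ) (v : TangentBundle 𝓘(ℝ, E) Q) (ζ : TangentSpace (𝓘(ℝ, E).tangent) v) :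
    tddot π v ζ = tangentDeriv₂ π v ζ := rfl

theorem tangentDeriv_chartAt {q₀ : Q} {p : TangentBundle 𝓘(ℝ, E) Q}
    (hp : p.proj ∈ (chartAt E q₀).source) :
    tangentDeriv (chartAt E q₀) p =
      (trivializationAt E (TangentSpace 𝓘(ℝ, E)) q₀ p).2 := by
  have h1 := TangentBundle.continuousLinearMapAt_trivializationAt (I := 𝓘(ℝ, E)) hp
  have h2 := congrArg (fun L => L p.2) h1
  have h3 : (chartAt E q₀ : Q → E) = extChartAt 𝓘(ℝ, E) q₀ := by ext; simp
  unfold tangentDeriv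
  rw [h3]
  refine Eq.trans h2.symm ?_
  erw [Bundle.Trivialization.continuousLinearMapAt_apply,
    Bundle.Trivialization.coe_linearMapAt_of_mem _ hp]

/-- The coordinates on `TQ` induced by the preferred chart at `q₀`. -/
def tangentCoord (q₀ : Q) (p : TangentBundle 𝓘(ℝ, E) Q) : E × E :=
  (chartAt E q₀ p.proj, tangentDeriv (chartAt E q₀) p)

theorem eventually_proj_mem (v : TangentBundle 𝓘(ℝ, E) Q) {s : Set Q} (hs : s ∈ 𝓝 v.proj) :
    ∀ᶠ p : TangentBundle 𝓘(ℝ, E) Q in 𝓝 v, p.proj ∈ s :=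
  (FiberBundle.continuous_proj E (TangentSpace 𝓘(ℝ, E))).continuousAt.eventually hs

theorem extChartAt_tangentBundle {v p : TangentBundle 𝓘(ℝ, E) Q}
    (hp : p.proj ∈ (chartAt E v.proj).source) :
    extChartAt 𝓘(ℝ, E).tangent v p = tangentCoord v.proj p := by
  unfold tangentCoord
  rw [tangentDeriv_chartAt hp]
  erw [FiberBundle.extChartAt]
  rfl

theorem contMDiffAt_chartAt {q₀ q : Q} (hq : q ∈ (chartAt E q₀).source) :
    ContMDiffAt 𝓘(ℝ, E) 𝓘(ℝ, E) ∞ (chartAt E q₀) q :=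
  (contMDiffOn_chart (I := 𝓘(ℝ, E)) (n := ∞) (x := q₀)).contMDiffAt
    ((chartAt E q₀).open_source.mem_nhds hq)

theorem contMDiffAt_tangentCoord {q₀ : Q} {v : TangentBundle 𝓘(ℝ, E) Q}
    (hv : v.proj ∈ (chartAt E q₀).source) :
    ContMDiffAt 𝓘(ℝ, E).tangent 𝓘(ℝ, E × E) ∞ (tangentCoord q₀) v := by
  have h1 : ContMDiffAt 𝓘(ℝ, E).tangent 𝓘(ℝ, E) ∞
      (fun p : TangentBundle 𝓘(ℝ, E) Q => chartAt E q₀ p.proj) v :=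
    (contMDiffAt_chartAt hv).comp v (Bundle.contMDiffAt_proj (TangentSpace 𝓘(ℝ, E)))
  have h2 : ContMDiffAt 𝓘(ℝ, E).tangent 𝓘(ℝ, E) ∞
      (tangentDeriv (E := E) (chartAt E q₀)) v := by
    have h3 : ContMDiffAt 𝓘(ℝ, E).tangent 𝓘(ℝ, E) ∞
      (fun p : TangentBundle 𝓘(ℝ, E) Q =>
        (trivializationAt E (TangentSpace 𝓘(ℝ, E)) q₀ p).2) v :=
      (((Bundle.Trivialization.contMDiffOn (n := ∞) (IB := 𝓘(ℝ, E))
        (trivializationAt E (TangentSpace 𝓘(ℝ, E)) q₀)).contMDiffAt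
        ((trivializationAt E (TangentSpace 𝓘(ℝ, E)) q₀).open_source.mem_nhds (by simpa using hv)))).snd
    refine h3.congr_of_eventuallyEq ?_
    filter_upwards [eventually_proj_mem v ((chartAt E q₀).open_source.mem_nhds hv)] with p hp
    exact tangentDeriv_chartAt hp
  exact h1.prodMk_space h2

/-- The tangent space of `TQ` at `v` is modelled on `E × E` through the preferred chart at `v`
itself. A tangent vector of `TQ` may thus be handled as the pair of its components there, and lifts
may be defined by formulas on pairs. -/
theorem mfderiv_tangentCoord_self (v : TangentBundle 𝓘(ℝ, E) Q) :
    mfderiv 𝓘(ℝ, E).tangent 𝓘(ℝ, E × E) (tangentCoord v.proj) v =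
      ContinuousLinearMap.id ℝ (E × E) := by
  have h : tangentCoord v.proj =ᶠ[𝓝 v] extChartAt 𝓘(ℝ, E).tangent v := by
    filter_upwards [eventually_proj_mem v
      ((chartAt E v.proj).open_source.mem_nhds (mem_chart_source E v.proj))] with p hp
    exact (extChartAt_tangentBundle hp).symm
  rw [h.mfderiv_eq]
  exact mfderiv_extChartAt_self

theorem mfderiv_chartAt_self (q : Q) :
    mfderiv 𝓘(ℝ, E) 𝓘(ℝ, E) (chartAt E q) q = ContinuousLinearMap.id ℝ E := by
  have h3 : (chartAt E q : Q → E) = extChartAt 𝓘(ℝ, E) q := by ext; simp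
  rw [h3]
  exact mfderiv_extChartAt_self

theorem tangentDeriv_chartAt_self (q : Q) (w : TangentSpace 𝓘(ℝ, E) q) :
    tangentDeriv (chartAt E q) (⟨q, w⟩ : TangentBundle 𝓘(ℝ, E) Q) = w := by
  unfold tangentDeriv
  erw [mfderiv_chartAt_self]
  rfl

theorem contDiffAt_comp_chartAt_symm {g : Q → G} {q₀ q : Q} (hq : q ∈ (chartAt E q₀).source)
    (hg : ContMDiffAt 𝓘(ℝ, E) 𝓘(ℝ, G) ∞ g q) :
    ContDiffAt ℝ ∞ (g ∘ (chartAt E q₀).symm) (chartAt E q₀ q) := by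
  rw [← contMDiffAt_iff_contDiffAt]
  have h := (contMDiffOn_chart_symm (I := 𝓘(ℝ, E)) (n := ∞) (x := q₀)).contMDiffAt
    ((chartAt E q₀).open_target.mem_nhds ((chartAt E q₀).map_source hq))
  refine ContMDiffAt.comp _ ?_ h
  rwa [(chartAt E q₀).left_inv hq]

/-- Order `∞` at a point need not provide one neighbourhood for all orders, hence the passage to
order one. The neighbourhood is needed because `tangentDeriv g` is differentiated in turn. -/
theorem eventually_mdifferentiableAt {g : Q → G} {q : Q}
    (hg : ContMDiffAt 𝓘(ℝ, E) 𝓘(ℝ, G) ∞ g q) :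
    ∀ᶠ q' in 𝓝 q, MDifferentiableAt 𝓘(ℝ, E) 𝓘(ℝ, G) g q' := by
  have h1 : ContMDiffAt 𝓘(ℝ, E) 𝓘(ℝ, G) 1 g q := hg.of_le (by norm_num)
  filter_upwards [(contMDiffAt_iff_contMDiffAt_nhds (by simp)).1 h1] with q' hq'
  exact hq'.mdifferentiableAt one_ne_zero

theorem mfderiv_eq_fderiv_chartAt {g : Q → G} {q₀ q : Q} (hq : q ∈ (chartAt E q₀).source)
    (hg : MDifferentiableAt 𝓘(ℝ, E) 𝓘(ℝ, G) g q) (w : TangentSpace 𝓘(ℝ, E) q) :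
    tangentDeriv g ⟨q, w⟩ = fderiv ℝ (g ∘ (chartAt E q₀).symm) (chartAt E q₀ q)
      (tangentDeriv (chartAt E q₀) ⟨q, w⟩) := by
  have hs := mdifferentiableAt_atlas_symm (I := 𝓘(ℝ, E)) (chart_mem_atlas E q₀)
    ((chartAt E q₀).map_source hq)
  have hc := mdifferentiableAt_atlas (I := 𝓘(ℝ, E)) (chart_mem_atlas E q₀) hq
  have hl := (chartAt E q₀).left_inv hq
  have hg' : MDifferentiableAt 𝓘(ℝ, E) 𝓘(ℝ, G) (g ∘ (chartAt E q₀).symm) (chartAt E q₀ q) :=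
    MDifferentiableAt.comp _ (by rwa [hl]) hs
  have he : g =ᶠ[𝓝 q] (g ∘ (chartAt E q₀).symm) ∘ chartAt E q₀ := by
    filter_upwards [(chartAt E q₀).open_source.mem_nhds hq] with y hy
    simp [(chartAt E q₀).left_inv hy]
  have hf := he.mfderiv_eq (I := 𝓘(ℝ, E)) (I' := 𝓘(ℝ, G))
  rw [mfderiv_comp q hg' hc] at hf
  have := congrArg (fun L => (L w : G)) hf
  simp only [mfderiv_eq_fderiv] at this
  exact this

theorem tangentDeriv_eventuallyEq {g : Q → G} {q₀ : Q} {v : TangentBundle 𝓘(ℝ, E) Q}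
    (hv : v.proj ∈ (chartAt E q₀).source) (hg : ContMDiffAt 𝓘(ℝ, E) 𝓘(ℝ, G) ∞ g v.proj) :
    tangentDeriv g =ᶠ[𝓝 v] (fun z : E × E => fderiv ℝ (g ∘ (chartAt E q₀).symm) z.1 z.2) ∘
      tangentCoord q₀ := by
  filter_upwards [eventually_proj_mem v ((chartAt E q₀).open_source.mem_nhds hv),
    eventually_proj_mem v (eventually_mdifferentiableAt hg)] with p hp hp'
  exact mfderiv_eq_fderiv_chartAt hp hp' p.2

theorem contDiffAt_fderiv_apply {f : E → G} {z : E × E} (hf : ContDiffAt ℝ ∞ f z.1) :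
    ContDiffAt ℝ ∞ (fun z : E × E => fderiv ℝ f z.1 z.2) z := by
  have h : ContDiffAt ℝ ∞ (fderiv ℝ f) z.1 := hf.fderiv_right (by norm_num)
  exact (h.comp z contDiffAt_fst).clm_apply contDiffAt_snd

theorem contMDiffAt_tangentDeriv {g : Q → G} {v : TangentBundle 𝓘(ℝ, E) Q}
    (hg : ContMDiffAt 𝓘(ℝ, E) 𝓘(ℝ, G) ∞ g v.proj) :
    ContMDiffAt 𝓘(ℝ, E).tangent 𝓘(ℝ, G) ∞ (tangentDeriv g) v := by
  have hv := mem_chart_source E v.proj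
  refine ContMDiffAt.congr_of_eventuallyEq ?_ (tangentDeriv_eventuallyEq hv hg)
  refine ContMDiffAt.comp v (ContDiffAt.contMDiffAt ?_) (contMDiffAt_tangentCoord hv)
  exact contDiffAt_fderiv_apply (contDiffAt_comp_chartAt_symm hv hg)

theorem mdifferentiableAt_tangentDeriv {g : Q → G} {v : TangentBundle 𝓘(ℝ, E) Q}
    (hg : ContMDiffAt 𝓘(ℝ, E) 𝓘(ℝ, G) ∞ g v.proj) :
    MDifferentiableAt 𝓘(ℝ, E).tangent 𝓘(ℝ, G) (tangentDeriv g) v :=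
  (contMDiffAt_tangentDeriv hg).mdifferentiableAt (by norm_num)

/-- The second differential of `g` in the preferred coordinates. -/
theorem exists_tangentDeriv₂_eq {g : Q → G} {q : Q} (hg : ContMDiffAt 𝓘(ℝ, E) 𝓘(ℝ, G) ∞ g q) :
    ∃ (L : E →L[ℝ] G) (B : E →L[ℝ] E →L[ℝ] G), (∀ x y, B x y = B y x) ∧
      (∀ w : TangentSpace 𝓘(ℝ, E) q, tangentDeriv g ⟨q, w⟩ = L w) ∧
      ∀ (v : TangentSpace 𝓘(ℝ, E) q) (ζ : TangentSpace 𝓘(ℝ, E).tangent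
        (⟨q, v⟩ : TangentBundle 𝓘(ℝ, E) Q)),
        tangentDeriv₂ g ⟨q, v⟩ ζ = L (show E × E from ζ).2 + B (show E × E from ζ).1 v := by
  have hq := mem_chart_source E q
  have hf := contDiffAt_comp_chartAt_symm hq hg
  set f := g ∘ (chartAt E q).symm
  have hf1 : ContDiffAt ℝ ∞ (fderiv ℝ f) (chartAt E q q) := hf.fderiv_right (by norm_num)
  -- First and second derivatives of `g` read in the chart at `q`; the formula is the product rule
  -- for `(x, u) ↦ Df(x) u`.
  refine ⟨fderiv ℝ f (chartAt E q q), fderiv ℝ (fderiv ℝ f) (chartAt E q q), ?_, ?_, ?_⟩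
  · intro x y
    exact hf.isSymmSndFDerivAt (by
      rw [minSmoothness_of_isRCLikeNormedField]
      exact ENat.LEInfty.out) x y
  · intro w
    rw [mfderiv_eq_fderiv_chartAt hq (hg.mdifferentiableAt (by norm_num)) w, tangentDeriv_chartAt_self]
  · intro v ζ
    have hG := contDiffAt_fderiv_apply (z := tangentCoord q ⟨q, v⟩) hf
    have hT := contMDiffAt_tangentCoord (v := (⟨q, v⟩ : TangentBundle 𝓘(ℝ, E) Q)) hq
    have he := (tangentDeriv_eventuallyEq (v := (⟨q, v⟩ : TangentBundle 𝓘(ℝ, E) Q)) hq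
      hg).mfderiv_eq (I := 𝓘(ℝ, E).tangent) (I' := 𝓘(ℝ, G))
    have hf1' : HasFDerivAt (fun z : E × E => fderiv ℝ f z.1) _
        (tangentCoord q (⟨q, v⟩ : TangentBundle 𝓘(ℝ, E) Q)) :=
      HasFDerivAt.comp (g := fderiv ℝ f) _
        (hf1.differentiableAt (by norm_num)).hasFDerivAt hasFDerivAt_fst
    have hd : HasFDerivAt (fun z : E × E => fderiv ℝ f z.1 z.2) _
        (tangentCoord q (⟨q, v⟩ : TangentBundle 𝓘(ℝ, E) Q)) :=
      hf1'.clm_apply hasFDerivAt_snd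
    have hc := mfderiv_comp (I := 𝓘(ℝ, E).tangent) (I' := 𝓘(ℝ, E × E)) (I'' := 𝓘(ℝ, G))
      (⟨q, v⟩ : TangentBundle 𝓘(ℝ, E) Q) hd.hasMFDerivAt.mdifferentiableAt
      (hT.mdifferentiableAt (by norm_num))
    rw [hc, hd.hasMFDerivAt.mfderiv] at he
    have := congrArg (fun L => (L ζ : G)) he
    refine Eq.trans this ?_
    erw [ContinuousLinearMap.comp_apply, mfderiv_tangentCoord_self ⟨q, v⟩]
    simp [tangentCoord, tangentDeriv_chartAt_self]
    rfl

theorem mdifferentiableAt_proj (v : TangentBundle 𝓘(ℝ, E) Q) :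
    MDifferentiableAt 𝓘(ℝ, E).tangent 𝓘(ℝ, E)
      (Bundle.TotalSpace.proj : TangentBundle 𝓘(ℝ, E) Q → Q) v :=
  (Bundle.contMDiffAt_proj (n := 1) (TangentSpace 𝓘(ℝ, E))).mdifferentiableAt one_ne_zero

theorem mfderiv_tangentCoord_apply {q₀ : Q} {v : TangentBundle 𝓘(ℝ, E) Q}
    (hv : v.proj ∈ (chartAt E q₀).source) (ζ : TangentSpace 𝓘(ℝ, E).tangent v) :
    mfderiv 𝓘(ℝ, E).tangent 𝓘(ℝ, E × E) (tangentCoord q₀) v ζ =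
      (tangentDeriv (chartAt E q₀) ⟨v.proj, Tproj v ζ⟩,
        tangentDeriv₂ (chartAt E q₀) v ζ) := by
  have hc := contMDiffAt_chartAt hv
  have h1 := (hc.mdifferentiableAt (by norm_num)).hasMFDerivAt.comp v
    (mdifferentiableAt_proj v).hasMFDerivAt
  have h2 := (mdifferentiableAt_tangentDeriv hc).hasMFDerivAt
  have h3 : mfderiv 𝓘(ℝ, E).tangent 𝓘(ℝ, E × E) (tangentCoord q₀) v = _ :=
    HasMFDerivAt.mfderiv ⟨h1.1.prodMk h2.1, h1.2.prodMk h2.2⟩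
  exact congrArg (fun L => (L ζ : E × E)) h3

theorem Tproj_apply (v : TangentBundle 𝓘(ℝ, E) Q) (ζ : TangentSpace 𝓘(ℝ, E).tangent v) :
    Tproj v ζ = (show E × E from ζ).1 := by
  have h := mfderiv_tangentCoord_apply (mem_chart_source E v.proj) ζ
  rw [mfderiv_tangentCoord_self] at h
  have h1 : (show E × E from ζ).1 = _ := congrArg (Prod.fst (α := E) (β := E)) h
  exact (h1.trans (tangentDeriv_chartAt_self _ _)).symm

theorem tangentDeriv₂_chartAt_self (v : TangentBundle 𝓘(ℝ, E) Q)
    (ζ : TangentSpace 𝓘(ℝ, E).tangent v) :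
    tangentDeriv₂ (chartAt E v.proj) v ζ = (show E × E from ζ).2 := by
  have h := mfderiv_tangentCoord_apply (mem_chart_source E v.proj) ζ
  rw [mfderiv_tangentCoord_self] at h
  exact (congrArg (Prod.snd (α := E) (β := E)) h).symm

/-- The trivialization of the second tangent bundle in the induced coordinates. -/
theorem trivializationAt_tangentBundle_apply {v₀ v : TangentBundle 𝓘(ℝ, E) Q}
    (hv : v.proj ∈ (chartAt E v₀.proj).source) (ζ : TangentSpace 𝓘(ℝ, E).tangent v) :
    (trivializationAt (E × E) (TangentSpace 𝓘(ℝ, E).tangent) v₀).continuousLinearMapAt ℝ v ζ =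
      (tangentDeriv (chartAt E v₀.proj) ⟨v.proj, Tproj v ζ⟩,
        tangentDeriv₂ (chartAt E v₀.proj) v ζ) := by
  have hv' : v ∈ (chartAt (ModelProd E E) v₀).source := by simpa using hv
  rw [TangentBundle.continuousLinearMapAt_trivializationAt hv', ← mfderiv_tangentCoord_apply hv]
  have h : tangentCoord v₀.proj =ᶠ[𝓝 v] extChartAt 𝓘(ℝ, E).tangent v₀ := by
    filter_upwards [eventually_proj_mem v ((chartAt E v₀.proj).open_source.mem_nhds hv)] with p hp
    exact (extChartAt_tangentBundle hp).symm
  rw [h.mfderiv_eq]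
  rfl

theorem exists_tangentDeriv_chartAt_eq {q₀ q : Q} (hq : q ∈ (chartAt E q₀).source) (e : E) :
    ∃ w : TangentSpace 𝓘(ℝ, E) q,
      tangentDeriv (chartAt E q₀) (⟨q, w⟩ : TangentBundle 𝓘(ℝ, E) Q) = e := by
  set t := trivializationAt E (TangentSpace 𝓘(ℝ, E)) q₀
  have hq' : q ∈ t.baseSet := hq
  refine ⟨t.symm q e, ?_⟩
  rw [tangentDeriv_chartAt (p := ⟨q, t.symm q e⟩) hq]
  exact congrArg Prod.snd (t.apply_mk_symm hq' e)

theorem symmL_tangentDeriv {q₀ q : Q} (hq : q ∈ (chartAt E q₀).source)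
    (w : TangentSpace 𝓘(ℝ, E) q) :
    (trivializationAt E (TangentSpace 𝓘(ℝ, E)) q₀).symmL ℝ q
      (tangentDeriv (chartAt E q₀) ⟨q, w⟩) = w := by
  set t := trivializationAt E (TangentSpace 𝓘(ℝ, E)) q₀
  have hq' : q ∈ t.baseSet := hq
  rw [tangentDeriv_chartAt (p := ⟨q, w⟩) hq]
  rw [Bundle.Trivialization.symmL_apply]
  · exact t.symm_apply_apply_mk hq' w
  · exact hq

/-! ### Smoothness of lifts through their components. -/

theorem inTangentCoordinates_lift_apply
    (K : ∀ v : TangentBundle 𝓘(ℝ, E) Q,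
      TangentSpace 𝓘(ℝ, E) v.proj →L[ℝ] TangentSpace (𝓘(ℝ, E).tangent) v)
    {v₀ v : TangentBundle 𝓘(ℝ, E) Q} (hv : v.proj ∈ (chartAt E v₀.proj).source)
    (w : TangentSpace 𝓘(ℝ, E) v.proj) :
    inTangentCoordinates 𝓘(ℝ, E) 𝓘(ℝ, E).tangent
      (Bundle.TotalSpace.proj : TangentBundle 𝓘(ℝ, E) Q → Q) id K v₀ v
        (tangentDeriv (chartAt E v₀.proj) ⟨v.proj, w⟩) =
      (tangentDeriv (chartAt E v₀.proj) ⟨v.proj, Tproj v (K v w)⟩,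
        tangentDeriv₂ (chartAt E v₀.proj) v (K v w)) := by
  rw [← trivializationAt_tangentBundle_apply hv]
  unfold inTangentCoordinates ContinuousLinearMap.inCoordinates
  have := symmL_tangentDeriv hv w
  erw [ContinuousLinearMap.comp_apply, ContinuousLinearMap.comp_apply, this]
  rfl

/-- A family of lifts is smooth if its components in the induced coordinates are. -/
theorem contMDiffWithinAt_inTangentCoordinates_lift
    {K : ∀ v : TangentBundle 𝓘(ℝ, E) Q,
      TangentSpace 𝓘(ℝ, E) v.proj →L[ℝ] TangentSpace (𝓘(ℝ, E).tangent) v}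
    {S : Set (TangentBundle 𝓘(ℝ, E) Q)} (hK : ∀ v ∈ S, ∀ w, Tproj v (K v w) = w)
    {v₀ : TangentBundle 𝓘(ℝ, E) Q} (hv₀ : v₀ ∈ S)
    {k : TangentBundle 𝓘(ℝ, E) Q → E →L[ℝ] E}
    (hk : ContMDiffWithinAt 𝓘(ℝ, E).tangent 𝓘(ℝ, E →L[ℝ] E) ∞ k S v₀)
    (h : ∀ᶠ v in 𝓝 v₀, v ∈ S → ∀ w : TangentSpace 𝓘(ℝ, E) v.proj,
      tangentDeriv₂ (chartAt E v₀.proj) v (K v w) =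
        k v (tangentDeriv (chartAt E v₀.proj) ⟨v.proj, w⟩)) :
    ContMDiffWithinAt 𝓘(ℝ, E).tangent 𝓘(ℝ, E →L[ℝ] E × E) ∞
      (inTangentCoordinates 𝓘(ℝ, E) 𝓘(ℝ, E).tangent
        (Bundle.TotalSpace.proj : TangentBundle 𝓘(ℝ, E) Q → Q) id K v₀) S v₀ := by
  -- A lift projects back to `w`, so its first component is the identity and only the fibre
  -- component `k` matters.
  have h1 : ContMDiffWithinAt 𝓘(ℝ, E).tangent 𝓘(ℝ, E →L[ℝ] E × E) ∞
      (fun v => ContinuousLinearMap.inl ℝ E E + (ContinuousLinearMap.inr ℝ E E).comp (k v)) S v₀ :=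
    contMDiffWithinAt_const.add (contMDiffWithinAt_const.clm_comp hk)
  have key : ∀ᶠ v in 𝓝 v₀, v ∈ S → inTangentCoordinates 𝓘(ℝ, E) 𝓘(ℝ, E).tangent
      (Bundle.TotalSpace.proj : TangentBundle 𝓘(ℝ, E) Q → Q) id K v₀ v =
      ContinuousLinearMap.inl ℝ E E + (ContinuousLinearMap.inr ℝ E E).comp (k v) := by
    filter_upwards [h, eventually_proj_mem v₀
      ((chartAt E v₀.proj).open_source.mem_nhds (mem_chart_source E v₀.proj))] with v hv hv' hvS
    refine ContinuousLinearMap.ext fun e => ?_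
    obtain ⟨w, rfl⟩ := exists_tangentDeriv_chartAt_eq hv' e
    refine (inTangentCoordinates_lift_apply K hv' w).trans ?_
    rw [hv hvS w, hK v hvS w]
    simp
  refine h1.congr_of_eventuallyEq ?_ (key.self_of_nhds hv₀)
  rwa [Filter.EventuallyEq, eventually_nhdsWithin_iff]

/-- The components of a smooth family of lifts are smooth. -/
theorem exists_contMDiffWithinAt_lift
    {K : ∀ v : TangentBundle 𝓘(ℝ, E) Q,
      TangentSpace 𝓘(ℝ, E) v.proj →L[ℝ] TangentSpace (𝓘(ℝ, E).tangent) v}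
    {S : Set (TangentBundle 𝓘(ℝ, E) Q)} {v₀ : TangentBundle 𝓘(ℝ, E) Q}
    (hK : SmoothLiftOn K S) (hv₀ : v₀ ∈ S) :
    ∃ k : TangentBundle 𝓘(ℝ, E) Q → E →L[ℝ] E,
      ContMDiffWithinAt 𝓘(ℝ, E).tangent 𝓘(ℝ, E →L[ℝ] E) ∞ k S v₀ ∧
      ∀ v : TangentBundle 𝓘(ℝ, E) Q, v.proj ∈ (chartAt E v₀.proj).source →
        ∀ w : TangentSpace 𝓘(ℝ, E) v.proj,
        tangentDeriv₂ (chartAt E v₀.proj) v (K v w) =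
          k v (tangentDeriv (chartAt E v₀.proj) ⟨v.proj, w⟩) := by
  refine ⟨fun v => (ContinuousLinearMap.snd ℝ E E).comp (inTangentCoordinates 𝓘(ℝ, E)
    𝓘(ℝ, E).tangent (Bundle.TotalSpace.proj : TangentBundle 𝓘(ℝ, E) Q → Q) id K v₀ v),
    contMDiffWithinAt_const.clm_comp (hK v₀ hv₀), fun v hv w => ?_⟩
  exact (congrArg (Prod.snd (α := E) (β := E)) (inTangentCoordinates_lift_apply K hv w)).symm

/-- The differential of `g` in coordinates, as a smooth covector-valued function. -/
theorem exists_contMDiffAt_tangentDeriv_eq {g : Q → G} {v₀ : TangentBundle 𝓘(ℝ, E) Q}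
    (hg : ContMDiffAt 𝓘(ℝ, E) 𝓘(ℝ, G) ∞ g v₀.proj) :
    ∃ P : TangentBundle 𝓘(ℝ, E) Q → E →L[ℝ] G,
      ContMDiffAt 𝓘(ℝ, E).tangent 𝓘(ℝ, E →L[ℝ] G) ∞ P v₀ ∧
      ∀ᶠ v : TangentBundle 𝓘(ℝ, E) Q in 𝓝 v₀, ∀ w : TangentSpace 𝓘(ℝ, E) v.proj,
        tangentDeriv g ⟨v.proj, w⟩ = P v (tangentDeriv (chartAt E v₀.proj) ⟨v.proj, w⟩) := by
  have hv := mem_chart_source E v₀.proj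
  have hf : ContDiffAt ℝ ∞ (fderiv ℝ (g ∘ (chartAt E v₀.proj).symm)) (chartAt E v₀.proj v₀.proj) :=
    (contDiffAt_comp_chartAt_symm hv hg).fderiv_right (by norm_num)
  refine ⟨fun v => fderiv ℝ (g ∘ (chartAt E v₀.proj).symm) (chartAt E v₀.proj v.proj), ?_, ?_⟩
  · exact hf.contMDiffAt.comp v₀
      ((contMDiffAt_chartAt hv).comp v₀ (Bundle.contMDiffAt_proj (TangentSpace 𝓘(ℝ, E))))
  · filter_upwards [eventually_proj_mem v₀ ((chartAt E v₀.proj).open_source.mem_nhds hv),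
      eventually_proj_mem v₀ (eventually_mdifferentiableAt hg)] with v hv hv' w
    exact mfderiv_eq_fderiv_chartAt hv hv' w

/-- A smooth function on `TQ` has a smooth fibre derivative. -/
theorem exists_contMDiffAt_hasDerivAt_fiber {h : TangentBundle 𝓘(ℝ, E) Q → G}
    {v₀ : TangentBundle 𝓘(ℝ, E) Q} (hh : ContMDiffAt 𝓘(ℝ, E).tangent 𝓘(ℝ, G) ∞ h v₀) :
    ∃ A : TangentBundle 𝓘(ℝ, E) Q → E →L[ℝ] G,
      ContMDiffAt 𝓘(ℝ, E).tangent 𝓘(ℝ, E →L[ℝ] G) ∞ A v₀ ∧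
      ∀ᶠ v : TangentBundle 𝓘(ℝ, E) Q in 𝓝 v₀, ∀ u : TangentSpace 𝓘(ℝ, E) v.proj,
        HasDerivAt (fun s : ℝ => h ⟨v.proj, v.2 + s • u⟩)
          (A v (tangentDeriv (chartAt E v₀.proj) ⟨v.proj, u⟩)) 0 := by
  have hv := mem_chart_source E v₀.proj
  set c := extChartAt 𝓘(ℝ, E).tangent v₀
  have hc0 : c v₀ = tangentCoord v₀.proj v₀ := extChartAt_tangentBundle hv
  have hH : ContDiffAt ℝ ∞ (h ∘ c.symm) (c v₀) := by
    rw [← contMDiffAt_iff_contDiffAt]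
    have h1 : ContMDiffAt 𝓘(ℝ, E × E) 𝓘(ℝ, E).tangent ∞ c.symm (c v₀) :=
      (contMDiffOn_extChartAt_symm (I := 𝓘(ℝ, E).tangent) (n := ∞) v₀).contMDiffAt
        (extChartAt_target_mem_nhds v₀)
    refine ContMDiffAt.comp _ ?_ h1
    rwa [extChartAt_to_inv]
  rw [hc0] at hH
  have hH1 : ContDiffAt ℝ ∞ (fderiv ℝ (h ∘ c.symm)) (tangentCoord v₀.proj v₀) :=
    hH.fderiv_right (by norm_num)
  have hT := contMDiffAt_tangentCoord hv
  refine ⟨fun v => (fderiv ℝ (h ∘ c.symm) (tangentCoord v₀.proj v)).comp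
    (ContinuousLinearMap.inr ℝ E E),
    (hH1.contMDiffAt.comp v₀ hT).clm_comp contMDiffAt_const, ?_⟩
  have hd : ∀ᶠ z in 𝓝 (tangentCoord v₀.proj v₀), DifferentiableAt ℝ (h ∘ c.symm) z := by
    filter_upwards [(hH.of_le (m := 1) (by norm_num)).eventually (by norm_num)] with z hz
    exact hz.differentiableAt one_ne_zero
  filter_upwards [hT.continuousAt.eventually hd,
    eventually_proj_mem v₀ ((chartAt E v₀.proj).open_source.mem_nhds hv)] with v hvd hvs u
  -- In induced coordinates a line in a fibre is a straight line with direction `(0, u)`.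
  have hline : HasDerivAt (fun s : ℝ => tangentCoord v₀.proj v +
      s • ((0 : E), tangentDeriv (chartAt E v₀.proj) (⟨v.proj, u⟩ : TangentBundle 𝓘(ℝ, E) Q)))
      ((0 : E), tangentDeriv (chartAt E v₀.proj) (⟨v.proj, u⟩ : TangentBundle 𝓘(ℝ, E) Q)) 0 := by
    simpa using ((hasDerivAt_id (0 : ℝ)).smul_const ((0 : E), tangentDeriv (chartAt E v₀.proj)
      (⟨v.proj, u⟩ : TangentBundle 𝓘(ℝ, E) Q))).const_add (tangentCoord v₀.proj v)
  have hcomp := HasFDerivAt.comp_hasDerivAt (0 : ℝ) (l := h ∘ c.symm) (f := fun s : ℝ =>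
    tangentCoord v₀.proj v +
      s • ((0 : E), tangentDeriv (chartAt E v₀.proj) (⟨v.proj, u⟩ : TangentBundle 𝓘(ℝ, E) Q)))
    (by simpa using hvd.hasFDerivAt) hline
  have heq : (fun s : ℝ => h ⟨v.proj, v.2 + s • u⟩) = (h ∘ c.symm) ∘ fun s : ℝ =>
      tangentCoord v₀.proj v +
      s • ((0 : E), tangentDeriv (chartAt E v₀.proj) (⟨v.proj, u⟩ : TangentBundle 𝓘(ℝ, E) Q)) := by
    funext s
    have h1 : tangentCoord v₀.proj v +
      s • ((0 : E), tangentDeriv (chartAt E v₀.proj) (⟨v.proj, u⟩ : TangentBundle 𝓘(ℝ, E) Q)) =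
        c ⟨v.proj, v.2 + s • u⟩ := by
      rw [extChartAt_tangentBundle (p := ⟨v.proj, v.2 + s • u⟩) hvs]
      simp [tangentCoord, tangentDeriv_add, tangentDeriv_smul]
    simp only [Function.comp_apply]
    rw [h1, c.left_inv]
    rw [extChartAt_source]
    simpa using hvs
  rw [heq]
  exact hcomp

/-! ### Reference frames. -/

/-- A fibre bundle over the time axis admits a reference frame. -/
theorem exists_vectorField_tdot_eq_one [FiniteDimensional ℝ E] [T2Space Q]
    [SecondCountableTopology Q]
    {π : Q → ℝ} (hπ : ContMDiff 𝓘(ℝ, E) 𝓘(ℝ, ℝ) ∞ π)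
    (hsub : ∀ q, ∃ w : TangentSpace 𝓘(ℝ, E) q, tdot π ⟨q, w⟩ = 1) :
    ∃ X : ∀ q : Q, TangentSpace 𝓘(ℝ, E) q,
      ContMDiff 𝓘(ℝ, E) 𝓘(ℝ, E).tangent ∞
        (fun q => (⟨q, X q⟩ : TangentBundle 𝓘(ℝ, E) Q)) ∧ ∀ q, tdot π ⟨q, X q⟩ = 1 := by
  have : LocallyCompactSpace Q := Manifold.locallyCompact_of_finiteDimensional 𝓘(ℝ, E)
  -- The condition `dt = 1` is affine in each fibre, so local solutions can be glued by a partition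
  -- of unity.
  have hconv : ∀ q : Q, Convex ℝ {w : TangentSpace 𝓘(ℝ, E) q | tdot π ⟨q, w⟩ = 1} := by
    intro q v hv w hw a b ha hb hab
    change tangentDeriv π ⟨q, _⟩ = 1
    change tangentDeriv π ⟨q, _⟩ = 1 at hv hw
    rw [tangentDeriv_add, tangentDeriv_smul, tangentDeriv_smul, hv, hw]
    simpa using hab
  obtain ⟨s, hs⟩ := exists_contMDiffSection_forall_mem_convex_of_local (n := ⊤)
    (F_fiber := E) 𝓘(ℝ, E)
    (TangentSpace 𝓘(ℝ, E) : Q → Type _) (fun q => {w | tdot π ⟨q, w⟩ = 1}) hconv (by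
    intro q
    obtain ⟨w, hw⟩ := hsub q
    set Y : ∀ q' : Q, TangentSpace 𝓘(ℝ, E) q' := FiberBundle.extend E w
    obtain ⟨U, hU, hY⟩ : ∃ U ∈ 𝓝 q, ContMDiffOn 𝓘(ℝ, E) 𝓘(ℝ, E).tangent ∞
        (fun q' => (⟨q', Y q'⟩ : TangentBundle 𝓘(ℝ, E) Q)) U :=
      FiberBundle.exists_contMDiffOn_extend 𝓘(ℝ, E) E w
    have hf : ContMDiffOn 𝓘(ℝ, E) 𝓘(ℝ, ℝ) ∞ (fun q' => tdot π ⟨q', Y q'⟩) U := fun q' hq' =>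
      (contMDiffAt_tangentDeriv (v := ⟨q', Y q'⟩) hπ.contMDiffAt).comp_contMDiffWithinAt q'
        (hY q' hq')
    have hYq : Y q = w := FiberBundle.extend_apply_self E w
    have hne : ∀ᶠ q' in 𝓝 q, tdot π ⟨q', Y q'⟩ ≠ 0 :=
      (hf.continuousOn.continuousAt hU).eventually_ne (by simp [hYq, hw])
    -- `dt(Y)` is `1` at `q`, hence nonzero nearby, and `Y / dt(Y)` is a local solution.
    refine ⟨U ∩ {q' | tdot π ⟨q', Y q'⟩ ≠ 0}, Filter.inter_mem hU hne,
      (fun q' => (tdot π ⟨q', Y q'⟩)⁻¹) • Y, ?_, ?_⟩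
    · exact ContMDiffOn.smul_section
        ((hf.mono inter_subset_left).inv₀ fun q' hq' => hq'.2) (hY.mono inter_subset_left)
    · intro q' hq'
      exact (tangentDeriv_smul π _ (Y q')).trans (inv_mul_cancel₀ hq'.2))
  exact ⟨s, s.contMDiff, hs⟩

theorem contMDiff_jetProjection {π : Q → ℝ} (hπ : ContMDiff 𝓘(ℝ, E) 𝓘(ℝ, ℝ) ∞ π)
    {X : ∀ q : Q, TangentSpace 𝓘(ℝ, E) q}
    (hX : ContMDiff 𝓘(ℝ, E) 𝓘(ℝ, E).tangent ∞
      (fun q => (⟨q, X q⟩ : TangentBundle 𝓘(ℝ, E) Q))) :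
    ContMDiff 𝓘(ℝ, E).tangent 𝓘(ℝ, E).tangent ∞ (jetProjection π X) := by
  intro v₀
  have hv := mem_chart_source E v₀.proj
  have hproj : ContMDiffAt 𝓘(ℝ, E).tangent 𝓘(ℝ, E) ∞
    (Bundle.TotalSpace.proj : TangentBundle 𝓘(ℝ, E) Q → Q) v₀ :=
    Bundle.contMDiffAt_proj (TangentSpace 𝓘(ℝ, E))
  refine Bundle.contMDiffAt_totalSpace.2 ⟨hproj, ?_⟩
  have hc := contMDiffAt_chartAt hv
  have h1 := contMDiffAt_tangentDeriv (v := v₀) hc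
  have h2 : ContMDiffAt 𝓘(ℝ, E).tangent 𝓘(ℝ, E) ∞ (fun v : TangentBundle 𝓘(ℝ, E) Q =>
      tangentDeriv (chartAt E v₀.proj) ⟨v.proj, X v.proj⟩) v₀ :=
    (contMDiffAt_tangentDeriv (v := ⟨v₀.proj, X v₀.proj⟩) hc).comp v₀
      ((hX v₀.proj).comp v₀ hproj)
  have h3 : ContMDiffAt 𝓘(ℝ, E).tangent 𝓘(ℝ, ℝ) ∞ (fun v : TangentBundle 𝓘(ℝ, E) Q =>
      1 - tdot π v) v₀ :=
    contMDiffAt_const.sub (contMDiffAt_tangentDeriv hπ.contMDiffAt)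
  refine (h1.add (h3.smul h2)).congr_of_eventuallyEq ?_
  filter_upwards [eventually_proj_mem v₀ ((chartAt E v₀.proj).open_source.mem_nhds hv)] with v hv'
  refine (tangentDeriv_chartAt (p := jetProjection π X v) hv').symm.trans ?_
  unfold jetProjection
  rw [tangentDeriv_add, tangentDeriv_smul]
  rfl

theorem eq_of_Tproj_eq_of_tangentDeriv₂_eq {v : TangentBundle 𝓘(ℝ, E) Q}
    {ζ ζ' : TangentSpace 𝓘(ℝ, E).tangent v} (h : Tproj v ζ = Tproj v ζ')
    (h' : tangentDeriv₂ (chartAt E v.proj) v ζ = tangentDeriv₂ (chartAt E v.proj) v ζ') :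
    ζ = ζ' := by
  rw [Tproj_apply, Tproj_apply] at h
  rw [tangentDeriv₂_chartAt_self, tangentDeriv₂_chartAt_self] at h'
  exact Prod.ext h h'

/-! ### Construction of `γ_ξ`. -/

/-- Components of a smooth second order vector field on `J¹Q`. -/
theorem IsHolonomicConnection.contMDiffWithinAt {π : Q → ℝ}
    {ξ : ∀ v : TangentBundle 𝓘(ℝ, E) Q, TangentSpace (𝓘(ℝ, E).tangent) v}
    (hξ : IsHolonomicConnection π ξ) {v₀ : TangentBundle 𝓘(ℝ, E) Q} (hv₀ : v₀ ∈ J1 π) :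
    ContMDiffWithinAt 𝓘(ℝ, E).tangent 𝓘(ℝ, E) ∞
      (fun v => tangentDeriv₂ (chartAt E v₀.proj) v (ξ v)) (J1 π) v₀ := by
  have h1 := (Bundle.contMDiffWithinAt_totalSpace.1 (hξ.smooth v₀ hv₀)).2
  have h2 : ContMDiffWithinAt 𝓘(ℝ, E).tangent 𝓘(ℝ, E) ∞ (fun v =>
      (trivializationAt (E × E) (TangentSpace 𝓘(ℝ, E).tangent) v₀ ⟨v, ξ v⟩).2.2) (J1 π) v₀ :=
    
    (contDiff_snd (𝕜 := ℝ) (E := E) (F := E)).contMDiff.contMDiffAt.comp_contMDiffWithinAt v₀ h1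
  have key : ∀ v : TangentBundle 𝓘(ℝ, E) Q, v.proj ∈ (chartAt E v₀.proj).source →
      tangentDeriv₂ (chartAt E v₀.proj) v (ξ v) =
        (trivializationAt (E × E) (TangentSpace 𝓘(ℝ, E).tangent) v₀ ⟨v, ξ v⟩).2.2 := by
    intro v hv
    have h3 := trivializationAt_tangentBundle_apply hv (ξ v)
    have hv' : v ∈ (chartAt (ModelProd E E) v₀).source := by simpa using hv
    refine (congrArg (Prod.snd (α := E) (β := E)) h3).symm.trans ?_
    rw [Bundle.Trivialization.continuousLinearMapAt_apply,
      Bundle.Trivialization.coe_linearMapAt_of_mem _ hv']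
  refine h2.congr_of_eventuallyEq ?_ (key v₀ (mem_chart_source E v₀.proj))
  filter_upwards [nhdsWithin_le_nhds (eventually_proj_mem v₀
    ((chartAt E v₀.proj).open_source.mem_nhds (mem_chart_source E v₀.proj)))] with v hv
  exact key v hv

/-- The fibre derivative of the components of `ξ` along `J¹Q`. -/
theorem IsHolonomicConnection.exists_fiberDeriv {π : Q → ℝ}
    (hπ : ContMDiff 𝓘(ℝ, E) 𝓘(ℝ, ℝ) ∞ π) {X : ∀ q : Q, TangentSpace 𝓘(ℝ, E) q}
    (hX : ContMDiff 𝓘(ℝ, E) 𝓘(ℝ, E).tangent ∞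
      (fun q => (⟨q, X q⟩ : TangentBundle 𝓘(ℝ, E) Q))) (hX1 : ∀ q, tdot π ⟨q, X q⟩ = 1)
    {ξ : ∀ v : TangentBundle 𝓘(ℝ, E) Q, TangentSpace (𝓘(ℝ, E).tangent) v}
    (hξ : IsHolonomicConnection π ξ) {v₀ : TangentBundle 𝓘(ℝ, E) Q} (hv₀ : v₀ ∈ J1 π) :
    ∃ A : TangentBundle 𝓘(ℝ, E) Q → E →L[ℝ] E,
      ContMDiffAt 𝓘(ℝ, E).tangent 𝓘(ℝ, E →L[ℝ] E) ∞ A v₀ ∧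
      ∀ᶠ v : TangentBundle 𝓘(ℝ, E) Q in 𝓝 v₀, v ∈ J1 π → ∀ w : TangentSpace 𝓘(ℝ, E) v.proj,
        HasDerivAt (fun s : ℝ => tangentDeriv₂ (chartAt E v₀.proj)
            ⟨v.proj, v.2 + s • (w - tdot π ⟨v.proj, w⟩ • v.2)⟩
            (ξ ⟨v.proj, v.2 + s • (w - tdot π ⟨v.proj, w⟩ • v.2)⟩))
          (A v (tangentDeriv (chartAt E v₀.proj) ⟨v.proj, w - tdot π ⟨v.proj, w⟩ • v.2⟩)) 0 := by
  have hr : jetProjection π X v₀ = v₀ := jetProjection_of_mem hv₀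
  -- The component of `ξ` is smooth only along `J¹Q`; composing with the retraction makes it smooth
  -- on `TQ` at `v₀`, without changing it on the lines inside `J¹Q`.
  have h : ContMDiffAt 𝓘(ℝ, E).tangent 𝓘(ℝ, E) ∞
      ((fun v => tangentDeriv₂ (chartAt E v₀.proj) v (ξ v)) ∘ jetProjection π X) v₀ := by
    have h1 := hξ.contMDiffWithinAt hv₀
    have h2 := (contMDiff_jetProjection hπ hX v₀).contMDiffWithinAt (s := univ)
    rw [← contMDiffWithinAt_univ]
    exact ContMDiffWithinAt.comp_of_eq h1 h2 (fun v _ => jetProjection_mem hX1 v) hr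
  obtain ⟨A, hA, hA'⟩ := exists_contMDiffAt_hasDerivAt_fiber h
  refine ⟨A, hA, ?_⟩
  filter_upwards [hA'] with v hv hvJ w
  convert hv (w - tdot π ⟨v.proj, w⟩ • v.2) using 2 with s
  simp only [Function.comp_apply]
  rw [jetProjection_of_mem (line_mem_J1 hvJ w s)]

/-- Pointwise construction of the connection `γ_ξ`. -/
theorem IsHolonomicConnection.exists_lift {π : Q → ℝ}
    (hπ : ContMDiff 𝓘(ℝ, E) 𝓘(ℝ, ℝ) ∞ π) {X : ∀ q : Q, TangentSpace 𝓘(ℝ, E) q}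
    (hX : ContMDiff 𝓘(ℝ, E) 𝓘(ℝ, E).tangent ∞
      (fun q => (⟨q, X q⟩ : TangentBundle 𝓘(ℝ, E) Q))) (hX1 : ∀ q, tdot π ⟨q, X q⟩ = 1)
    {ξ : ∀ v : TangentBundle 𝓘(ℝ, E) Q, TangentSpace (𝓘(ℝ, E).tangent) v}
    (hξ : IsHolonomicConnection π ξ) {v : TangentBundle 𝓘(ℝ, E) Q} (hv : v ∈ J1 π) :
    ∃ L : TangentSpace 𝓘(ℝ, E) v.proj →L[ℝ] TangentSpace (𝓘(ℝ, E).tangent) v,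
      ∀ w, Tproj v (L w) = w ∧ ∃ d : E,
        HasDerivAt (fun s : ℝ => tangentDeriv₂ (chartAt E v.proj)
            ⟨v.proj, v.2 + s • (w - tdot π ⟨v.proj, w⟩ • v.2)⟩
            (ξ ⟨v.proj, v.2 + s • (w - tdot π ⟨v.proj, w⟩ • v.2)⟩)) d 0 ∧
        tangentDeriv₂ (chartAt E v.proj) v (L w) =
          tdot π ⟨v.proj, w⟩ • tangentDeriv₂ (chartAt E v.proj) v (ξ v) + (1 / 2 : ℝ) • d := by
  obtain ⟨A, -, hA⟩ := hξ.exists_fiberDeriv hπ hX hX1 hv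
  replace hA := hA.self_of_nhds hv
  set P : E →L[ℝ] ℝ := mfderiv 𝓘(ℝ, E) 𝓘(ℝ, ℝ) π v.proj
  refine ⟨show E →L[ℝ] E × E from (ContinuousLinearMap.id ℝ E).prod
    (P.smulRight (show E × E from ξ v).2 + (1 / 2 : ℝ) • (A v).comp
      (ContinuousLinearMap.id ℝ E - P.smulRight (show E from v.2))),
    fun w => ⟨Tproj_apply v _, _, hA w, ?_⟩⟩
  rw [tangentDeriv₂_chartAt_self, tangentDeriv₂_chartAt_self, tangentDeriv_chartAt_self]
  rfl

/-- The defining formula of `γ_ξ` holds for the second differential of every function as soon as it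
holds for the preferred chart. -/
theorem IsHolonomicConnection.tangentDeriv₂_lift {π : Q → ℝ}
    {ξ : ∀ v : TangentBundle 𝓘(ℝ, E) Q, TangentSpace (𝓘(ℝ, E).tangent) v}
    (hξ : IsHolonomicConnection π ξ) {v : TangentBundle 𝓘(ℝ, E) Q} (hv : v ∈ J1 π)
    {g : Q → G} (hg : ContMDiffAt 𝓘(ℝ, E) 𝓘(ℝ, G) ∞ g v.proj)
    {ζ : TangentSpace (𝓘(ℝ, E).tangent) v} {w : TangentSpace 𝓘(ℝ, E) v.proj}
    (hζ : Tproj v ζ = w) {d : E}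
    (hd : HasDerivAt (fun s : ℝ => tangentDeriv₂ (chartAt E v.proj)
      ⟨v.proj, v.2 + s • (w - tdot π ⟨v.proj, w⟩ • v.2)⟩
      (ξ ⟨v.proj, v.2 + s • (w - tdot π ⟨v.proj, w⟩ • v.2)⟩)) d 0)
    (hζd : tangentDeriv₂ (chartAt E v.proj) v ζ =
      tdot π ⟨v.proj, w⟩ • tangentDeriv₂ (chartAt E v.proj) v (ξ v) + (1 / 2 : ℝ) • d) :
    tangentDeriv₂ g v ζ = tdot π ⟨v.proj, w⟩ • tangentDeriv₂ g v (ξ v) +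
      (1 / 2 : ℝ) • deriv (fun s : ℝ => tangentDeriv₂ g
        ⟨v.proj, v.2 + s • (w - tdot π ⟨v.proj, w⟩ • v.2)⟩
        (ξ ⟨v.proj, v.2 + s • (w - tdot π ⟨v.proj, w⟩ • v.2)⟩)) 0 := by
  obtain ⟨L, B, hB, -, hLB⟩ := exists_tangentDeriv₂_eq hg
  set a : ℝ := tdot π ⟨v.proj, w⟩ with ha
  set u : E := v.2 with hu
  set y : E := w - a • v.2 with hy
  have hline : HasDerivAt (fun s : ℝ => u + s • y) y 0 := by
    simpa using ((hasDerivAt_id (0 : ℝ)).smul_const y).const_add u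
  -- By symmetry of `B` this is `2 B(y, u)`, which the factor `1/2` in the definition of `γ_ξ` turns
  -- into `B(y, u)`.
  have hquad : HasDerivAt (fun s : ℝ => B (u + s • y) (u + s • y)) (B y u + B u y) 0 := by
    have := (B.hasFDerivAt.comp_hasDerivAt (0 : ℝ) hline).clm_apply hline
    simpa using this
  have hsum := (L.hasFDerivAt.comp_hasDerivAt (0 : ℝ) hd).add hquad
  have hfun (s : ℝ) : tangentDeriv₂ g ⟨v.proj, u + s • y⟩ (ξ ⟨v.proj, u + s • y⟩) =
      L (tangentDeriv₂ (chartAt E v.proj) ⟨v.proj, u + s • y⟩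
        (ξ ⟨v.proj, u + s • y⟩)) + B (u + s • y) (u + s • y) := by
    have h1 := hξ.holonomic _ (line_mem_J1 hv w s)
    rw [Tproj_apply] at h1
    have h2 := tangentDeriv₂_chartAt_self (⟨v.proj, u + s • y⟩ : TangentBundle 𝓘(ℝ, E) Q)
      (ξ ⟨v.proj, u + s • y⟩)
    refine (hLB _ _).trans ?_
    rw [← h2]
    exact congrArg (fun z => L _ + B z (u + s • y)) h1
  have hξv : tangentDeriv₂ g v (ξ v) = L (tangentDeriv₂ (chartAt E v.proj) v (ξ v)) + B u u := by
    have h1 := hξ.holonomic _ hv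
    rw [Tproj_apply] at h1
    refine (hLB v.2 _).trans ?_
    rw [tangentDeriv₂_chartAt_self]
    exact congrArg (fun z => L _ + B z u) h1
  have hζ' : tangentDeriv₂ g v ζ = L (tangentDeriv₂ (chartAt E v.proj) v ζ) + B w u := by
    rw [Tproj_apply] at hζ
    refine (hLB v.2 _).trans ?_
    rw [tangentDeriv₂_chartAt_self]
    exact congrArg (fun z => L _ + B z u) hζ
  have hder : deriv (fun s : ℝ => tangentDeriv₂ g ⟨v.proj, u + s • y⟩
      (ξ ⟨v.proj, u + s • y⟩)) 0 = L d + (B y u + B u y) := by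
    refine HasDerivAt.deriv (hsum.congr_of_eventuallyEq (Filter.Eventually.of_forall fun s => ?_))
    exact hfun s
  have hw : (w : E) = a • u + y := (add_sub_cancel (a • u) (w : E)).symm
  rw [hζ', hζd, hξv]
  refine Eq.trans ?_ (congrArg (fun z => a • _ + (1 / 2 : ℝ) • z) hder).symm
  rw [hw, hB u y]
  simp only [map_add, map_smul, add_apply, smul_apply]
  module

/-- All four properties come from the transformation formula `tangentDeriv₂_lift`: with the chart at
`v₀` for smoothness near `v₀`, with `π` for tangency, with an arbitrary chart for the components,
and with the chart at `v` for the generation of `ξ`. -/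
theorem IsHolonomicConnection.exists_isAssociatedConnection {π : Q → ℝ}
    (hπ : ContMDiff 𝓘(ℝ, E) 𝓘(ℝ, ℝ) ∞ π) {X : ∀ q : Q, TangentSpace 𝓘(ℝ, E) q}
    (hX : ContMDiff 𝓘(ℝ, E) 𝓘(ℝ, E).tangent ∞
      (fun q => (⟨q, X q⟩ : TangentBundle 𝓘(ℝ, E) Q))) (hX1 : ∀ q, tdot π ⟨q, X q⟩ = 1)
    {ξ : ∀ v : TangentBundle 𝓘(ℝ, E) Q, TangentSpace (𝓘(ℝ, E).tangent) v}
    (hξ : IsHolonomicConnection π ξ) :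
    ∃ γ : ∀ v : TangentBundle 𝓘(ℝ, E) Q,
        TangentSpace 𝓘(ℝ, E) v.proj →L[ℝ] TangentSpace (𝓘(ℝ, E).tangent) v,
      IsDynamicConnection π γ ∧ IsAssociatedConnection π ξ γ ∧ Generates π γ ξ := by
  classical
  choose γ' hγ' d hd hγd using fun v (hv : v ∈ J1 π) => hξ.exists_lift hπ hX hX1 hv
  set γ : ∀ v : TangentBundle 𝓘(ℝ, E) Q,
      TangentSpace 𝓘(ℝ, E) v.proj →L[ℝ] TangentSpace (𝓘(ℝ, E).tangent) v :=
    fun v => if hv : v ∈ J1 π then γ' v hv else 0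
  have hγ (v) (hv : v ∈ J1 π) : γ v = γ' v hv := dif_pos hv
  have hlift : ∀ v ∈ J1 π, ∀ w, Tproj v (γ v w) = w := fun v hv w => by
    rw [hγ v hv]; exact hγ' v hv w
  have hform {G : Type _} [NormedAddCommGroup G] [NormedSpace ℝ G] (g : Q → G)
      (v) (hv : v ∈ J1 π) (hg : ContMDiffAt 𝓘(ℝ, E) 𝓘(ℝ, G) ∞ g v.proj) (w) :=
    hξ.tangentDeriv₂_lift hv hg (hγ' v hv w) (hd v hv w) (hγd v hv w)
  -- The local `hform` has a fixed universe for its target, so the case of `π` is stated separately.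
  have hformR (v) (hv : v ∈ J1 π) (w) :=
    hξ.tangentDeriv₂_lift hv (hπ v.proj) (hγ' v hv w) (hd v hv w) (hγd v hv w)
  refine ⟨γ, ⟨?_, ?_, hlift⟩, ?_, ?_⟩
  · intro v₀ hv₀
    obtain ⟨A, hA, hA'⟩ := hξ.exists_fiberDeriv hπ hX hX1 hv₀
    obtain ⟨P, hP, hP'⟩ := exists_contMDiffAt_tangentDeriv_eq (v₀ := v₀) (hπ v₀.proj)
    have hv := mem_chart_source E v₀.proj
    have hT := contMDiffAt_tangentDeriv (v := v₀) (contMDiffAt_chartAt hv)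
    have hf := hξ.contMDiffWithinAt hv₀
    have hsm {S : Set (TangentBundle 𝓘(ℝ, E) Q)} {p : TangentBundle 𝓘(ℝ, E) Q → E →L[ℝ] ℝ}
        {f : TangentBundle 𝓘(ℝ, E) Q → E} (hp : ContMDiffWithinAt 𝓘(ℝ, E).tangent
        𝓘(ℝ, E →L[ℝ] ℝ) ∞ p S v₀) (hf : ContMDiffWithinAt 𝓘(ℝ, E).tangent 𝓘(ℝ, E) ∞ f S v₀) :
        ContMDiffWithinAt 𝓘(ℝ, E).tangent 𝓘(ℝ, E →L[ℝ] E) ∞ (fun v => (p v).smulRight (f v)) S v₀ :=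
      (contMDiffWithinAt_const (c := ContinuousLinearMap.smulRightL ℝ E E)).clm_apply hp
        |>.clm_apply hf
    have hhalf : ContMDiffWithinAt 𝓘(ℝ, E).tangent 𝓘(ℝ, ℝ) ∞
        (fun _ : TangentBundle 𝓘(ℝ, E) Q => (1 / 2 : ℝ)) (J1 π) v₀ := contMDiffWithinAt_const
    refine contMDiffWithinAt_inTangentCoordinates_lift hlift hv₀
      (k := fun v => (P v).smulRight (tangentDeriv₂ (chartAt E v₀.proj) v (ξ v)) +
        (1 / 2 : ℝ) • (A v).comp (ContinuousLinearMap.id ℝ E -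
          (P v).smulRight (tangentDeriv (chartAt E v₀.proj) v))) ?_ ?_
    · exact (hsm hP.contMDiffWithinAt hf).add (hhalf.smul
        (hA.contMDiffWithinAt.clm_comp (contMDiffWithinAt_const.sub
          (hsm hP.contMDiffWithinAt hT.contMDiffWithinAt))))
    · filter_upwards [hA', hP', eventually_proj_mem v₀
        ((chartAt E v₀.proj).open_source.mem_nhds hv)] with v hvA hvP hvs hvJ w
      rw [hγ v hvJ, hform _ v hvJ (contMDiffAt_chartAt hvs) w, (hvA hvJ w).deriv, sub_eq_add_neg,
        ← neg_smul, tangentDeriv_add, tangentDeriv_smul]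
      change tangentDeriv π _ • _ + _ • (A v) (_ + (-(tangentDeriv π _)) • _) = _
      rw [hvP w]
      simp [sub_eq_add_neg]
  · intro v hv w
    rw [hγ v hv, tddot_eq, hformR v hv w, ← tddot_eq, hξ.tangent v hv]
    have : (fun s : ℝ => tangentDeriv₂ π
        ⟨v.proj, v.2 + s • (w - tdot π ⟨v.proj, w⟩ • v.2)⟩
        (ξ ⟨v.proj, v.2 + s • (w - tdot π ⟨v.proj, w⟩ • v.2)⟩)) = fun _ => 0 :=
      funext fun s => hξ.tangent _ (line_mem_J1 hv w s)
    rw [this]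
    simp
  · intro φ hφ q v w hq hv
    rw [hγ _ hv]
    exact hform φ _ hv ((contMDiffOn_of_mem_maximalAtlas hφ).contMDiffAt
      (φ.open_source.mem_nhds hq)) w
  · intro v hv
    refine eq_of_Tproj_eq_of_tangentDeriv₂_eq ((hlift v hv _).trans (hξ.holonomic v hv).symm) ?_
    rw [hγ v hv, hform _ v hv (contMDiffAt_chartAt (mem_chart_source E v.proj))]
    have h1 : tdot π ⟨v.proj, v.2⟩ = 1 := hv
    -- For `w = v` the vertical part is zero: the line is constant and the derivative term drops
    -- out.
    have h2 (s : ℝ) : (⟨v.proj, v.2 + s • (v.2 - tdot π ⟨v.proj, v.2⟩ • v.2)⟩ :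
        TangentBundle 𝓘(ℝ, E) Q) = v := by
      rw [h1, one_smul, sub_self, smul_zero, add_zero]
    have h3 := funext fun s => congrArg (fun p => tangentDeriv₂ (chartAt E v.proj) p (ξ p)) (h2 s)
    rw [h3, h1]
    simp

/-! ### Extension of a dynamic connection to `TQ`. -/

/-- Extension of a dynamic connection along a reference frame, pointwise. -/
theorem exists_lift_extension (π : Q → ℝ) (X : ∀ q : Q, TangentSpace 𝓘(ℝ, E) q)
    (γ : ∀ v : TangentBundle 𝓘(ℝ, E) Q,
      TangentSpace 𝓘(ℝ, E) v.proj →L[ℝ] TangentSpace (𝓘(ℝ, E).tangent) v)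
    (v : TangentBundle 𝓘(ℝ, E) Q) :
    ∃ L : TangentSpace 𝓘(ℝ, E) v.proj →L[ℝ] TangentSpace (𝓘(ℝ, E).tangent) v,
      ∀ w, Tproj v (L w) = w ∧ tangentDeriv₂ (chartAt E v.proj) v (L w) =
        tangentDeriv₂ (chartAt E v.proj) (jetProjection π X v) (γ (jetProjection π X v) w) -
          (1 - tdot π v) • tangentDeriv (fun q => tangentDeriv (chartAt E v.proj)
            (⟨q, X q⟩ : TangentBundle 𝓘(ℝ, E) Q)) ⟨v.proj, w⟩ := by
  set M : E →L[ℝ] E := mfderiv 𝓘(ℝ, E) 𝓘(ℝ, E) (fun q => tangentDeriv (chartAt E v.proj)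
    (⟨q, X q⟩ : TangentBundle 𝓘(ℝ, E) Q)) v.proj
  set N : E →L[ℝ] E × E := γ (jetProjection π X v)
  refine ⟨show E →L[ℝ] E × E from (ContinuousLinearMap.id ℝ E).prod
    ((ContinuousLinearMap.snd ℝ E E).comp N - (1 - tdot π v) • M),
    fun w => ⟨Tproj_apply v _, ?_⟩⟩
  rw [tangentDeriv₂_chartAt_self]
  refine Eq.trans ?_ (congrArg (· - _) (tangentDeriv₂_chartAt_self (jetProjection π X v) _).symm)
  rfl

/-- The correction term becomes a second differential at `X q`, so that its `B`-term can be compared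
with those of the lifts. -/
theorem tangentDeriv_comp_vectorField {X : ∀ q : Q, TangentSpace 𝓘(ℝ, E) q}
    (hX : ContMDiff 𝓘(ℝ, E) 𝓘(ℝ, E).tangent ∞
      (fun q => (⟨q, X q⟩ : TangentBundle 𝓘(ℝ, E) Q)))
    {g : Q → G} {q : Q} (hg : ContMDiffAt 𝓘(ℝ, E) 𝓘(ℝ, G) ∞ g q) (w : TangentSpace 𝓘(ℝ, E) q) :
    tangentDeriv (fun q => tangentDeriv g (⟨q, X q⟩ : TangentBundle 𝓘(ℝ, E) Q)) ⟨q, w⟩ =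
      tangentDeriv₂ g ⟨q, X q⟩ (mfderiv 𝓘(ℝ, E) 𝓘(ℝ, E).tangent
        (fun q => (⟨q, X q⟩ : TangentBundle 𝓘(ℝ, E) Q)) q w) := by
  have h := mfderiv_comp q (mdifferentiableAt_tangentDeriv (v := ⟨q, X q⟩) hg)
    ((hX q).mdifferentiableAt (by norm_num))
  exact congrArg (fun L => (L w : G)) h

theorem Tproj_mfderiv_vectorField {X : ∀ q : Q, TangentSpace 𝓘(ℝ, E) q}
    (hX : ContMDiff 𝓘(ℝ, E) 𝓘(ℝ, E).tangent ∞
      (fun q => (⟨q, X q⟩ : TangentBundle 𝓘(ℝ, E) Q))) (q : Q) (w : TangentSpace 𝓘(ℝ, E) q) :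
    Tproj ⟨q, X q⟩ (mfderiv 𝓘(ℝ, E) 𝓘(ℝ, E).tangent
        (fun q => (⟨q, X q⟩ : TangentBundle 𝓘(ℝ, E) Q)) q w) = w := by
  have h := mfderiv_comp q (mdifferentiableAt_proj ⟨q, X q⟩)
    ((hX q).mdifferentiableAt (by norm_num))
  have h' : (Bundle.TotalSpace.proj ∘ fun q => (⟨q, X q⟩ : TangentBundle 𝓘(ℝ, E) Q)) = id := rfl
  rw [h', mfderiv_id] at h
  exact (congrArg (fun L => (L w : E)) h).symm

/-- The defining formula of the extension holds for the second differential of every function. -/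
theorem IsDynamicConnection.tangentDeriv₂_lift {π : Q → ℝ} {X : ∀ q : Q, TangentSpace 𝓘(ℝ, E) q}
    (hX : ContMDiff 𝓘(ℝ, E) 𝓘(ℝ, E).tangent ∞
      (fun q => (⟨q, X q⟩ : TangentBundle 𝓘(ℝ, E) Q))) (hX1 : ∀ q, tdot π ⟨q, X q⟩ = 1)
    {γ : ∀ v : TangentBundle 𝓘(ℝ, E) Q,
      TangentSpace 𝓘(ℝ, E) v.proj →L[ℝ] TangentSpace (𝓘(ℝ, E).tangent) v}
    (hγ : IsDynamicConnection π γ) {v : TangentBundle 𝓘(ℝ, E) Q}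
    {g : Q → G} (hg : ContMDiffAt 𝓘(ℝ, E) 𝓘(ℝ, G) ∞ g v.proj)
    {ζ : TangentSpace (𝓘(ℝ, E).tangent) v} {w : TangentSpace 𝓘(ℝ, E) v.proj}
    (hζ : Tproj v ζ = w)
    (hζ' : tangentDeriv₂ (chartAt E v.proj) v ζ =
      tangentDeriv₂ (chartAt E v.proj) (jetProjection π X v) (γ (jetProjection π X v) w) -
        (1 - tdot π v) • tangentDeriv (fun q => tangentDeriv (chartAt E v.proj)
          (⟨q, X q⟩ : TangentBundle 𝓘(ℝ, E) Q)) ⟨v.proj, w⟩) :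
    tangentDeriv₂ g v ζ =
      tangentDeriv₂ g (jetProjection π X v) (γ (jetProjection π X v) w) -
        (1 - tdot π v) • tangentDeriv (fun q => tangentDeriv g
          (⟨q, X q⟩ : TangentBundle 𝓘(ℝ, E) Q)) ⟨v.proj, w⟩ := by
  obtain ⟨L, B, -, -, hLB⟩ := exists_tangentDeriv₂_eq hg
  have key (u : TangentSpace 𝓘(ℝ, E) v.proj)
      (η : TangentSpace (𝓘(ℝ, E).tangent) (⟨v.proj, u⟩ : TangentBundle 𝓘(ℝ, E) Q))
      (h : Tproj ⟨v.proj, u⟩ η = w) : tangentDeriv₂ g ⟨v.proj, u⟩ η =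
        L (tangentDeriv₂ (chartAt E v.proj) ⟨v.proj, u⟩ η) + B w u := by
    rw [Tproj_apply] at h
    refine (hLB u η).trans ?_
    have h2 := tangentDeriv₂_chartAt_self (⟨v.proj, u⟩ : TangentBundle 𝓘(ℝ, E) Q) η
    rw [← h2]
    exact congrArg (fun z => L _ + B z u) h
  rw [tangentDeriv_comp_vectorField hX hg, key _ _ (Tproj_mfderiv_vectorField hX v.proj w)]
  rw [tangentDeriv_comp_vectorField hX (contMDiffAt_chartAt (mem_chart_source E v.proj))] at hζ'
  have h1 := key v.2 ζ hζ
  have h2 := key _ (γ (jetProjection π X v) w) (hγ.lift _ (jetProjection_mem hX1 v) w)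
  refine h1.trans ?_
  refine Eq.trans ?_ (congrArg (· - _) h2).symm
  refine (congrArg (fun z => L z + B w v.2) hζ').trans ?_
  -- The excess `(1 - ṫ) B(w, X)` is cancelled by the `B`-term of the correction.
  have h3 : B w (v.2 + (1 - tdot π v) • X v.proj) = B w v.2 + (1 - tdot π v) • B w (X v.proj) :=
    (map_add (B w) _ _).trans (congrArg (_ + ·) (map_smul (B w) _ _))
  rw [h3, map_sub, map_smul]
  unfold jetProjection
  module

/-! ### Shifted solutions. -/

theorem acceleration_comp_sub_const (c : ℝ → Q) (a s : ℝ) :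
    acceleration (E := E) (fun s => c (s - a)) s = acceleration c (s - a) := by
  have h : velocity (E := E) (fun s => c (s - a)) = fun s => velocity c (s - a) :=
    funext (velocity_comp_sub_const c a)
  unfold acceleration
  rw [h, mfderiv_comp_sub_const (I := 𝓘(ℝ, E).tangent) (velocity c) a s]

/-- Second order equations are autonomous: solutions may be shifted. -/
theorem IsSolution.comp_sub_const
    {S : Set (TangentBundle 𝓘(ℝ, E).tangent (TangentBundle 𝓘(ℝ, E) Q))} {J : Set ℝ} {c : ℝ → Q}
    (h : IsSolution S J c) (a : ℝ) :
    IsSolution S ((fun s => s - a) ⁻¹' J) fun s => c (s - a) := by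
  refine ⟨h.1.comp (contDiff_id.sub contDiff_const).contMDiff.contMDiffOn fun s hs => hs,
    fun s hs => ?_⟩
  rw [acceleration_comp_sub_const]
  exact h.2 _ hs

/-! ### Global extension and equality of the two equations. -/

theorem IsDynamicConnection.exists_extension {π : Q → ℝ}
    (hπ : ContMDiff 𝓘(ℝ, E) 𝓘(ℝ, ℝ) ∞ π) {X : ∀ q : Q, TangentSpace 𝓘(ℝ, E) q}
    (hX : ContMDiff 𝓘(ℝ, E) 𝓘(ℝ, E).tangent ∞
      (fun q => (⟨q, X q⟩ : TangentBundle 𝓘(ℝ, E) Q))) (hX1 : ∀ q, tdot π ⟨q, X q⟩ = 1)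
    {γ : ∀ v : TangentBundle 𝓘(ℝ, E) Q,
      TangentSpace 𝓘(ℝ, E) v.proj →L[ℝ] TangentSpace (𝓘(ℝ, E).tangent) v}
    (hγ : IsDynamicConnection π γ) :
    ∃ K : ∀ v : TangentBundle 𝓘(ℝ, E) Q,
        TangentSpace 𝓘(ℝ, E) v.proj →L[ℝ] TangentSpace (𝓘(ℝ, E).tangent) v,
      IsConnection K ∧ (∀ v w, tddot π v (K v w) = 0) ∧ ∀ v ∈ J1 π, K v = γ v := by
  choose K hK hK' using exists_lift_extension π X γ
  refine ⟨K, ⟨?_, hK⟩, ?_, ?_⟩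
  · intro v₀ _
    have hv := mem_chart_source E v₀.proj
    have hc := contMDiffAt_chartAt hv
    obtain ⟨k, hk, hk'⟩ := exists_contMDiffWithinAt_lift (v₀ := jetProjection π X v₀) hγ.smooth
      (jetProjection_mem hX1 v₀)
    have hg : ContMDiffAt 𝓘(ℝ, E) 𝓘(ℝ, E) ∞ (fun q => tangentDeriv (chartAt E v₀.proj)
        (⟨q, X q⟩ : TangentBundle 𝓘(ℝ, E) Q)) v₀.proj :=
      (contMDiffAt_tangentDeriv (v := ⟨v₀.proj, X v₀.proj⟩) hc).comp v₀.proj (hX v₀.proj)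
    obtain ⟨P, hP, hP'⟩ := exists_contMDiffAt_tangentDeriv_eq (v₀ := v₀) hg
    have h1 : ContMDiffAt 𝓘(ℝ, E).tangent 𝓘(ℝ, E →L[ℝ] E) ∞ (k ∘ jetProjection π X) v₀ := by
      rw [← contMDiffWithinAt_univ]
      exact hk.comp v₀ (contMDiff_jetProjection hπ hX v₀).contMDiffWithinAt
        fun v _ => jetProjection_mem hX1 v
    have h2 : ContMDiffAt 𝓘(ℝ, E).tangent 𝓘(ℝ, ℝ) ∞ (fun v : TangentBundle 𝓘(ℝ, E) Q =>
        1 - tdot π v) v₀ := contMDiffAt_const.sub (contMDiffAt_tangentDeriv (hπ v₀.proj))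
    refine contMDiffWithinAt_inTangentCoordinates_lift (fun v _ => hK v) (mem_univ v₀)
      (k := fun v => k (jetProjection π X v) - (1 - tdot π v) • P v)
      (h1.sub (h2.smul hP)).contMDiffWithinAt ?_
    filter_upwards [hP', eventually_proj_mem v₀
      ((chartAt E v₀.proj).open_source.mem_nhds hv)] with v hvP hvs _ w
    rw [hγ.tangentDeriv₂_lift hX hX1 (contMDiffAt_chartAt hvs) (hK v w) (hK' v w), hvP w]
    exact congrArg (· - _) (hk' (jetProjection π X v) hvs w)
  · intro v w
    rw [tddot_eq, hγ.tangentDeriv₂_lift hX hX1 (hπ v.proj) (hK v w) (hK' v w)]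
    have h1 := hγ.tangent _ (jetProjection_mem hX1 v) w
    rw [tddot_eq] at h1
    -- For `g = π` the correction is the differential of `dt(X) = 1`, hence zero.
    have h2 : (fun q => tangentDeriv π (⟨q, X q⟩ : TangentBundle 𝓘(ℝ, E) Q)) = fun _ => 1 :=
      funext hX1
    have h3 : tangentDeriv (fun _ : Q => (1 : ℝ)) ⟨v.proj, w⟩ = 0 := by
      unfold tangentDeriv
      rw [mfderiv_const]
      rfl
    rw [h1, h2, h3, smul_zero, sub_zero]
  · intro v hv
    refine ContinuousLinearMap.ext fun w => ?_
    refine eq_of_Tproj_eq_of_tangentDeriv₂_eq ((hK v w).trans (hγ.lift v hv w).symm) ?_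
    have h1 : tdot π v = 1 := hv
    -- The type of `γ v w` depends on `v`, so the equality of `r(v)` with `v` is substituted through
    -- a free variable `u`.
    have h2 (u : TangentSpace 𝓘(ℝ, E) v.proj) (hu : u = v.2) :
        tangentDeriv₂ (chartAt E v.proj) ⟨v.proj, u⟩ (γ ⟨v.proj, u⟩ w) =
          tangentDeriv₂ (chartAt E v.proj) v (γ v w) := by
      subst hu
      rfl
    rw [hK' v w, h1, sub_self, zero_smul, sub_zero]
    exact h2 _ (by rw [h1, sub_self, zero_smul, add_zero])

theorem geodesicEquation_eq_dynamicEquation {π : Q → ℝ}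
    {ξ : ∀ v : TangentBundle 𝓘(ℝ, E) Q, TangentSpace (𝓘(ℝ, E).tangent) v}
    {γ K : ∀ v : TangentBundle 𝓘(ℝ, E) Q,
      TangentSpace 𝓘(ℝ, E) v.proj →L[ℝ] TangentSpace (𝓘(ℝ, E).tangent) v}
    (hγ : Generates π γ ξ) (hK : ∀ v w, tddot π v (K v w) = 0) (hKγ : ∀ v ∈ J1 π, K v = γ v) :
    geodesicEquation π K = dynamicEquation π ξ := by
  have key : ∀ v ∈ J1 π, K v v.2 = ξ v := fun v hv => by rw [hKγ v hv, hγ v hv]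
  ext ζ
  constructor
  · rintro ⟨-, h, v, rfl⟩
    exact ⟨v, h, by simp only [key v h]⟩
  · rintro ⟨v, hv, rfl⟩
    exact ⟨by simp only [← key v hv, hK], hv, v, by simp only [key v hv]⟩

end TimeBundle

end

theorem theorem5p2
    {E : Type*} [NormedAddCommGroup E] [NormedSpace ℝ E] [FiniteDimensional ℝ E]
    {Q : Type*} [TopologicalSpace Q] [ChartedSpace E Q] [IsManifold 𝓘(ℝ, E) ∞ Q]
    [T2Space Q] [SecondCountableTopology Q]
    {F : Type*} [NormedAddCommGroup F] [NormedSpace ℝ F] [FiniteDimensional ℝ F]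
    {M : Type*} [TopologicalSpace M] [ChartedSpace F M] [IsManifold 𝓘(ℝ, F) ∞ M]
    (π : Q → ℝ) (hπ : TimeBundle.IsSmoothBundle (E := E) F M π)
    (ξ : ∀ v : TangentBundle 𝓘(ℝ, E) Q, TangentSpace (𝓘(ℝ, E).tangent) v)
    (hξ : TimeBundle.IsHolonomicConnection π ξ) :
    -- the dynamic connection `γ_ξ` exists and generates `ξ`
    (∃ γ : ∀ v : TangentBundle 𝓘(ℝ, E) Q,
        TangentSpace 𝓘(ℝ, E) v.proj →L[ℝ] TangentSpace (𝓘(ℝ, E).tangent) v,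
      TimeBundle.IsDynamicConnection π γ ∧ TimeBundle.IsAssociatedConnection π ξ γ ∧
        TimeBundle.Generates π γ ξ) ∧
    -- every dynamic connection `γ` generating `ξ` extends to a connection on `TQ → Q`
    ∀ γ : ∀ v : TangentBundle 𝓘(ℝ, E) Q,
        TangentSpace 𝓘(ℝ, E) v.proj →L[ℝ] TangentSpace (𝓘(ℝ, E).tangent) v,
      TimeBundle.IsDynamicConnection π γ → TimeBundle.Generates π γ ξ →
      (∃ K : ∀ v : TangentBundle 𝓘(ℝ, E) Q,
          TangentSpace 𝓘(ℝ, E) v.proj →L[ℝ] TangentSpace (𝓘(ℝ, E).tangent) v,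
        TimeBundle.IsConnection K ∧ (∀ v w, TimeBundle.tddot π v (K v w) = 0) ∧
          ∀ v ∈ TimeBundle.J1 π, K v = γ v) ∧
      -- and for every such extension the geodesic equation is equivalent to the dynamic equation
      ∀ K : ∀ v : TangentBundle 𝓘(ℝ, E) Q,
          TangentSpace 𝓘(ℝ, E) v.proj →L[ℝ] TangentSpace (𝓘(ℝ, E).tangent) v,
        TimeBundle.IsConnection K → (∀ v w, TimeBundle.tddot π v (K v w) = 0) →
        (∀ v ∈ TimeBundle.J1 π, K v = γ v) →
        TimeBundle.geodesicEquation π K = TimeBundle.dynamicEquation π ξ ∧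
        ∀ J : Set ℝ, IsOpen J → J.OrdConnected → ∀ c : ℝ → Q,
          (TimeBundle.IsMotion π ξ J c ↔
            (∀ t ∈ J, π (c t) = t) ∧
              TimeBundle.IsSolution (TimeBundle.geodesicEquation π K) J c) ∧
          (TimeBundle.IsSolution (TimeBundle.geodesicEquation π K) J c ↔
            ∃ a : ℝ, TimeBundle.IsMotion π ξ ((fun s => s - a) ⁻¹' J) fun s => c (s - a)) := by
  have hπs := hπ.contMDiff
  obtain ⟨X, hX, hX1⟩ := TimeBundle.exists_vectorField_tdot_eq_one hπs hπ.exists_tdot_eq_one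
  refine ⟨hξ.exists_isAssociatedConnection hπs hX hX1, fun γ hγ hγξ =>
    ⟨hγ.exists_extension hπs hX hX1, fun K _ hK hKγ => ?_⟩⟩
  have hEq := TimeBundle.geodesicEquation_eq_dynamicEquation hγξ hK hKγ
  refine ⟨hEq, fun J hJ hJc c => ⟨by rw [hEq, TimeBundle.IsMotion], ?_, ?_⟩⟩
  · intro h
    obtain ⟨a, ha⟩ := TimeBundle.exists_forall_eq_add_of_tdot_eq_one hπs hJ hJc h.1
      fun s hs => (h.2 s hs).2.1
    refine ⟨a, fun t ht => ?_, ?_⟩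
    · rw [ha _ ht, sub_add_cancel]
    · rw [← hEq]
      exact h.comp_sub_const a
  · rintro ⟨a, -, h⟩
    -- Shifting back by `-a` recovers `c` and `J`; the section property is not needed in this
    -- direction.
    have h1 := h.comp_sub_const (-a)
    simpa [hEq, Set.preimage_preimage] using h1
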